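/- Let $\Bbbk$ be an algebraically closed field and let $n\geq 2$ be an integer. Let $\Lambda_n$ be the $\Bbbk$-algebra given by the quiver with vertices $1,\dots,n$ and arrows $\alpha_i\colon i\to i+1$ and $\alpha_i'\colon i+1\to i$ for $1\leq i\leq n-1$, subject to the relations $\alpha_{i+1}\alpha_i=0$, $\alpha_i'\alpha_{i+1}'=0$ (for $1\leq i\leq n-2$) and $\alpha_i\alpha_i'=0$ (for $1\leq i\leq n-1$), where paths are composed from right to left, like functions. All modules are finite-dimensional left $\Lambda_n$-modules. Let $L(i)$ be the simple module at the vertex $i$. The standard module $\Delta(i)$ and the costandard module $\nabla(i)$ are given by $\Delta(1)=\nabla(1)=L(1)$ and, for $2\leq i\leq n$, by the two-dimensional representations of the quiver with one basis vector at $i$ and one at $i-1$ such that on $\Delta(i)$ the arrow $\alpha_{i-1}'$ maps the basis vector at $i$ to the one at $i-1$, on $\nabla(i)$ the arrow $\alpha_{i-1}$ maps the basis vector at $i-1$ to the one at $i$, and all other arrows act by zero. Let $\mathcal{F}(\Delta)$ (respectively $\mathcal{F}(\nabla)$) be the class of modules that have a finite filtration all of whose subquotients are isomorphic to standard (respectively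 costandard) modules. A module $M$ is called self-orthogonal if $\operatorname{Ext}^m_{\Lambda_n}(M,M)=0$ for all $m\geq 1$. A module $T$ is called a generalized tilting module if it has finite projective dimension, is self-orthogonal, and admits an exact sequence $0\to\Lambda_n\to Q_0\to Q_1\to\dots\to Q_r\to 0$ in which every $Q_i$ is a direct summand of a finite direct sum of copies of $T$. (1) Let $M\in\mathcal{F}(\nabla)$ and $N\in\mathcal{F}(\Delta)$ be indecomposable and self-orthogonal modules, neither of which lies in $\mathcal{F}(\Delta)\cap\mathcal{F}(\nabla)$. Then $\operatorname{Ext}^m_{\Lambda_n}(M,N)\neq 0$ for some $m\geq 1$. (2) Every generalized tilting $\Lambda_n$-module lies in $\mathcal{F}(\Delta)$ or in $\mathcal{F}(\nabla)$. -/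

import Mathlib

universe u

open CategoryTheory

namespace DualExt

/-! ## The algebra `Λ_n` -/

/-- Trivial paths and arrows of the quiver of `Λ_n`. The vertices `1, …, n` are the elements
`0, …, n - 1` of `Fin n`. -/
inductive Gen (n : ℕ) : Type
  /-- the trivial path at `i` -/
  | e (i : Fin n) : Gen n
  /-- the arrow `α_i : i ⟶ j`, where `j = i + 1` -/
  | up (i j : Fin n) (h : (i : ℕ) + 1 = j) : Gen n
  /-- the arrow `α'_i : j ⟶ i`, where `j = i + 1` -/
  | down (i j : Fin n) (h : (i : ℕ) + 1 = j) : Gen n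

section Algebra

variable (k : Type u) [Field k] (n : ℕ)

/-- The free generator of `k⟨Gen n⟩` attached to a trivial path or an arrow. -/
abbrev gen (x : Gen n) : FreeAlgebra k (Gen n) := FreeAlgebra.ι k x

open Gen in
/-- The relations of `Λ_n`. The first six say that we are in the path algebra of the quiver (paths
are composed like functions, from right to left); the last three are
`α_{i+1} α_i = 0`, `α'_i α'_{i+1} = 0` and `α_i α'_i = 0`. -/
inductive Rel : FreeAlgebra k (Gen n) → FreeAlgebra k (Gen n) → Prop
  | sum_e : Rel (∑ i : Fin n, gen k n (e i)) 1
  | e_mul_e (i j : Fin n) :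
      Rel (gen k n (e i) * gen k n (e j)) (if i = j then gen k n (e i) else 0)
  | up_source (i j : Fin n) (h : (i : ℕ) + 1 = j) :
      Rel (gen k n (up i j h) * gen k n (e i)) (gen k n (up i j h))
  | up_target (i j : Fin n) (h : (i : ℕ) + 1 = j) :
      Rel (gen k n (e j) * gen k n (up i j h)) (gen k n (up i j h))
  | down_source (i j : Fin n) (h : (i : ℕ) + 1 = j) :
      Rel (gen k n (down i j h) * gen k n (e j)) (gen k n (down i j h))
  | down_target (i j : Fin n) (h : (i : ℕ) + 1 = j) :
      Rel (gen k n (e i) * gen k n (down i j h)) (gen k n (down i j h))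
  | up_up (i j l : Fin n) (h : (i : ℕ) + 1 = j) (h' : (j : ℕ) + 1 = l) :
      Rel (gen k n (up j l h') * gen k n (up i j h)) 0
  | down_down (i j l : Fin n) (h : (i : ℕ) + 1 = j) (h' : (j : ℕ) + 1 = l) :
      Rel (gen k n (down i j h) * gen k n (down j l h')) 0
  | up_down (i j : Fin n) (h : (i : ℕ) + 1 = j) :
      Rel (gen k n (up i j h) * gen k n (down i j h)) 0

/-- The algebra `Λ_n`: the path algebra of the double of the linear quiver `1 → 2 → ⋯ → n`
modulo the relations above. -/
abbrev Lam : Type u := RingQuot (Rel k n)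

end Algebra

/-! ## Standard and costandard modules -/

section Structural

variable (k : Type u) [Field k] {n : ℕ}

/-- The vertices `i` and (if it exists) `i - 1`. -/
abbrev Supp (i : Fin n) : Type := {j : Fin n // j = i ∨ (j : ℕ) + 1 = i}

/-- The linear map `v ↦ v_a • e_b` on `k^(Supp i)`; it is zero unless `a, b ∈ {i - 1, i}`. -/
def unitMap (i a b : Fin n) : Module.End k (Supp i → k) where
  toFun v c := if h : c.1 = b ∧ (a = i ∨ (a : ℕ) + 1 = i) then v ⟨a, h.2⟩ else 0
  map_add' v w := by ext c; by_cases h : c.1 = b ∧ (a = i ∨ (a : ℕ) + 1 = i) <;> simp [h]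
  map_smul' t v := by ext c; by_cases h : c.1 = b ∧ (a = i ∨ (a : ℕ) + 1 = i) <;> simp [h]

/-- The action on `Δ(i)`: it has basis vectors at `i` and `i - 1`, the arrow `i ⟶ i - 1` takes the
first to the second, and all other arrows act by zero. -/
def standardGen (i : Fin n) : Gen n → Module.End k (Supp i → k)
  | .e a => unitMap k i a a
  | .up _ _ _ => 0
  | .down a b _ => if b = i then unitMap k i b a else 0

/-- The action on `∇(i)`: it has basis vectors at `i` and `i - 1`, the arrow `i - 1 ⟶ i` takes the
second to the first, and all other arrows act by zero. -/
def costandardGen (i : Fin n) : Gen n → Module.End k (Supp i → k)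
  | .e a => unitMap k i a a
  | .up a b _ => if b = i then unitMap k i a b else 0
  | .down _ _ _ => 0

theorem unitMap_apply (i a b : Fin n) (v : Supp i → k) (c : Supp i) :
    unitMap k i a b v c =
      if h : c.1 = b ∧ (a = i ∨ (a : ℕ) + 1 = i) then v ⟨a, h.2⟩ else 0 := rfl

theorem sum_unitMap (i : Fin n) : ∑ a : Fin n, unitMap k i a a = 1 := by
  refine LinearMap.ext fun v => funext fun c => ?_
  rw [LinearMap.sum_apply, Finset.sum_apply, Finset.sum_eq_single c.1]
  · simp [unitMap_apply, c.2]
  · intro b _ hb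
    simp [unitMap_apply, hb.symm]
  · simp

theorem unitMap_mul_of_ne (i : Fin n) {a b c d : Fin n} (h : b ≠ c) :
    unitMap k i c d * unitMap k i a b = 0 := by
  refine LinearMap.ext fun v => funext fun x => ?_
  simp [unitMap_apply, h.symm]

theorem unitMap_mul (i : Fin n) {a b d : Fin n} (h : b = i ∨ (b : ℕ) + 1 = i) :
    unitMap k i b d * unitMap k i a b = unitMap k i a d := by
  refine LinearMap.ext fun v => funext fun x => ?_
  by_cases h1 : x.1 = d <;> by_cases h2 : a = i ∨ (a : ℕ) + 1 = i <;>
    simp [unitMap_apply, h, h1, h2]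

theorem unitMap_idem (i a : Fin n) : unitMap k i a a * unitMap k i a a = unitMap k i a a := by
  by_cases h : a = i ∨ (a : ℕ) + 1 = i
  · exact unitMap_mul k i h
  · refine LinearMap.ext fun v => funext fun x => ?_
    simp [unitMap_apply, h]

theorem standardGen_rel (i : Fin n) ⦃x y : FreeAlgebra k (Gen n)⦄ (h : Rel k n x y) :
    FreeAlgebra.lift k (standardGen k i) x = FreeAlgebra.lift k (standardGen k i) y := by
  cases h with
  | sum_e => simpa [standardGen] using sum_unitMap k i
  | e_mul_e a b =>
    by_cases hab : a = b
    · subst hab; simpa [standardGen] using unitMap_idem k i a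
    · simpa [standardGen, hab] using unitMap_mul_of_ne k i (Ne.symm hab)
  | up_source a b h => simp [standardGen]
  | up_target a b h => simp [standardGen]
  | down_source a b h =>
    by_cases hb : b = i
    · simpa [standardGen, hb] using unitMap_mul k i (Or.inl rfl)
    · simp [standardGen, hb]
  | down_target a b h =>
    by_cases hb : b = i
    · subst hb; simpa [standardGen] using unitMap_mul k b (Or.inr h)
    · simp [standardGen, hb]
  | up_up a b c h h' => simp [standardGen]
  | down_down a b c h h' =>
    by_cases hb : b = i
    · have hc : c ≠ i := by rintro rfl; subst hb; omega
      simp [standardGen, hc]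
    · simp [standardGen, hb]
  | up_down a b h => simp [standardGen]

theorem costandardGen_rel (i : Fin n) ⦃x y : FreeAlgebra k (Gen n)⦄ (h : Rel k n x y) :
    FreeAlgebra.lift k (costandardGen k i) x = FreeAlgebra.lift k (costandardGen k i) y := by
  cases h with
  | sum_e => simpa [costandardGen] using sum_unitMap k i
  | e_mul_e a b =>
    by_cases hab : a = b
    · subst hab; simpa [costandardGen] using unitMap_idem k i a
    · simpa [costandardGen, hab] using unitMap_mul_of_ne k i (Ne.symm hab)
  | up_source a b h =>
    by_cases hb : b = i
    · subst hb; simpa [costandardGen] using unitMap_mul k b (Or.inr h)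
    · simp [costandardGen, hb]
  | up_target a b h =>
    by_cases hb : b = i
    · simpa [costandardGen, hb] using unitMap_mul k i (Or.inl rfl)
    · simp [costandardGen, hb]
  | down_source a b h => simp [costandardGen]
  | down_target a b h => simp [costandardGen]
  | up_up a b c h h' =>
    by_cases hb : b = i
    · have hc : c ≠ i := by rintro rfl; subst hb; omega
      simp [costandardGen, hc]
    · simp [costandardGen, hb]
  | down_down a b c h h' => simp [costandardGen]
  | up_down a b h => simp [costandardGen]

/-- The representation `Λ_n → End_k(k^(Supp i))` defining `Δ(i)`. -/
noncomputable def standardHom (i : Fin n) : Lam k n →ₐ[k] Module.End k (Supp i → k) :=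
  RingQuot.liftAlgHom k ⟨FreeAlgebra.lift k (standardGen k i), standardGen_rel k i⟩

/-- The representation `Λ_n → End_k(k^(Supp i))` defining `∇(i)`. -/
noncomputable def costandardHom (i : Fin n) : Lam k n →ₐ[k] Module.End k (Supp i → k) :=
  RingQuot.liftAlgHom k ⟨FreeAlgebra.lift k (costandardGen k i), costandardGen_rel k i⟩

/-- The standard module `Δ(i)`, with top `L(i)` and (for `i` not the first vertex) socle
`L(i - 1)`. -/
noncomputable def standard (i : Fin n) : ModuleCat.{u} (Lam k n) :=
  letI : Module (Lam k n) (Supp i → k) := Module.compHom _ (standardHom k i).toRingHom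
  ModuleCat.of (Lam k n) (Supp i → k)

/-- The costandard module `∇(i)`, with socle `L(i)` and (for `i` not the first vertex) top
`L(i - 1)`. -/
noncomputable def costandard (i : Fin n) : ModuleCat.{u} (Lam k n) :=
  letI : Module (Lam k n) (Supp i → k) := Module.compHom _ (costandardHom k i).toRingHom
  ModuleCat.of (Lam k n) (Supp i → k)

end Structural

/-! ## Filtrations -/

/-- `M` has a finite filtration `0 = F 0 ≤ F 1 ≤ ⋯ ≤ F r = M` all of whose subquotients are
isomorphic to members of the family `S`. -/
def HasFiltration {A : Type u} [Ring A] {ι : Type} (S : ι → ModuleCat.{u} A)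
    (M : ModuleCat.{u} A) : Prop :=
  ∃ (r : ℕ) (F : ℕ → Submodule A M), F 0 = ⊥ ∧ F r = ⊤ ∧
    ∀ t < r, F t ≤ F (t + 1) ∧
      ∃ i, Nonempty ((F (t + 1) ⧸ (F t).submoduleOf (F (t + 1))) ≃ₗ[A] S i)

section Categories

variable {k : Type u} [Field k] {n : ℕ}

/-- `M` is finite-dimensional over `k`. -/
def IsFinDim (M : ModuleCat.{u} (Lam k n)) : Prop :=
  Module.Finite k ((ModuleCat.restrictScalars (algebraMap k (Lam k n))).obj M)

/-- The (objects of the) category `F(Δ)`. -/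
def InFDelta (M : ModuleCat.{u} (Lam k n)) : Prop :=
  IsFinDim M ∧ HasFiltration (standard k (n := n)) M

/-- The (objects of the) category `F(∇)`. -/
def InFNabla (M : ModuleCat.{u} (Lam k n)) : Prop :=
  IsFinDim M ∧ HasFiltration (costandard k (n := n)) M

end Categories

/-! ## Self-orthogonal modules and generalized tilting modules -/

section Tilting

variable {A : Type u} [Ring A]

/-- `Ext^m(M, M) = 0` for all `m > 0`. -/
def IsSelfOrthogonal (M : ModuleCat.{u} A) : Prop :=
  ∀ m : ℕ, 0 < m → Subsingleton (Abelian.Ext M M m)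

/-- `X` belongs to `add T`: it is a direct summand of a finite direct sum of copies of `T`. -/
def InAdd (T X : ModuleCat.{u} A) : Prop :=
  ∃ m : ℕ, Nonempty (Retract X (ModuleCat.of A (Fin m → T)))

/-- There is an exact sequence `0 → A → Q 0 → Q 1 → ⋯ → Q r → 0` with all `Q i` in `add T`
(the sequence is continued by zero modules). -/
def HasAddCoresolution (T : ModuleCat.{u} A) : Prop :=
  ∃ (r : ℕ) (Q : ℕ → ModuleCat.{u} A) (f : ModuleCat.of A A ⟶ Q 0)
    (d : ∀ i, Q i ⟶ Q (i + 1)),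
    (∀ i ≤ r, InAdd T (Q i)) ∧ (∀ i, r < i → Limits.IsZero (Q i)) ∧
    Function.Injective f ∧ Function.Exact f (d 0) ∧ ∀ i, Function.Exact (d i) (d (i + 1))

/-- Generalized tilting modules in the sense of Miyashita. -/
structure IsGeneralizedTilting (T : ModuleCat.{u} A) : Prop where
  finite_projDim : ∃ d : ℕ, HasProjectiveDimensionLE T d
  selfOrthogonal : IsSelfOrthogonal T
  coresolution : HasAddCoresolution T

end Tilting

end DualExt

/-!
A module `M` over `Λ_n` is a graded vector space `M_1, …, M_n` with a differential `α` of degree `1`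
and a differential `α'` of degree `-1` such that `α α' = 0`. Both parts of the theorem follow from
two facts, in which vertices are numbered from `1`.

* If `M` is finite-dimensional and its homology with respect to `α'` vanishes at all vertices
  `i ≥ 2`, then `M` lies in `F(Δ)` (`hasFiltration_standard`): for the largest vertex `m` of the
  support, an element of `M_m` generates a copy of `Δ(m)`, and the quotient is again exact away from
  the first vertex. Dually, a module whose homology with respect to `α` vanishes at all `i ≥ 2` lies
  in `F(∇)` (`hasFiltration_costandard`).
* If `M` has nonzero homology with respect to `α'` at `j ≥ 2` and `N` has nonzero homology with
  respect to `α` at `i ≥ 2`, then `Ext^{i+j-2}(M, N) ≠ 0` (`nontrivial_ext_of_homology`).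

Hence `Ext^m(M, N) ≠ 0` for some `m ≥ 1` whenever `M` is not in `F(Δ)` and `N` is not in `F(∇)`. The
first part of the theorem is the case of `M` in `F(∇)` and `N` in `F(Δ)`, and the second part is the
case `M = N = T`.

For the second fact, projective modules have no homology with respect to `α'` away from the first
vertex, and injective modules have none with respect to `α`
(`not_lowerHomologyAt_of_projective`, `not_raiseHomologyAt_of_injective`): the uniserial module with
composition factors `L(i - 1)`, `L(i)`, `L(i - 1)` contains `Δ(i)` and maps onto `∇(i)`, and a
nonzero homology class would give a map to or from it that cannot be lifted or extended. Thus passing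
to a syzygy of `M` or a cosyzygy of `N` lowers `j` or `i` by one together with the degree of `Ext`,
which reduces the claim to `i = j = 2` (`nontrivial_ext_two`). There the two classes define a
homomorphism `K → L(1) → C` from the syzygy of `M` to the cosyzygy of `N`. It is not of the form
`K → P → I → C`, with `P` projective and `I` injective, because the class of `M` becomes a boundary
`α' p` in `P`, and `α α' = 0` makes its image in `I` a cycle for `α`.
-/

namespace DualExt

/-! ### Generators of the algebra -/

section Generators

variable (k : Type u) [Field k] {n : ℕ}

/-- The image in `Λ_n` of a trivial path or an arrow. -/
noncomputable def lamGen (g : Gen n) : Lam k n := RingQuot.mkAlgHom k (Rel k n) (gen k n g)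

/-- The idempotent of `Λ_n` at the vertex `i`. -/
noncomputable abbrev idem (i : Fin n) : Lam k n := lamGen k (.e i)

variable (n) in
/-- The sum of all arrows `α_i` of `Λ_n`; it raises vertices by one. -/
noncomputable def raise : Lam k n :=
  ∑ i : Fin n, ∑ j : Fin n, if h : (i : ℕ) + 1 = j then lamGen k (.up i j h) else 0

variable (n) in
/-- The sum of all arrows `α'_i` of `Λ_n`; it lowers vertices by one. -/
noncomputable def lower : Lam k n :=
  ∑ i : Fin n, ∑ j : Fin n, if h : (i : ℕ) + 1 = j then lamGen k (.down i j h) else 0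

theorem sum_idem : ∑ i : Fin n, idem k i = 1 := by
  simpa [lamGen] using RingQuot.mkAlgHom_rel k (Rel.sum_e (k := k) (n := n))

theorem idem_mul_idem (i j : Fin n) :
    idem k i * idem k j = if i = j then idem k i else 0 := by
  have := RingQuot.mkAlgHom_rel k (Rel.e_mul_e (k := k) (n := n) i j)
  split_ifs at this ⊢ <;> simpa [lamGen] using this

theorem lamGen_up_mul_idem {i j : Fin n} (h : (i : ℕ) + 1 = j) (a : Fin n) :
    lamGen k (.up i j h) * idem k a = if i = a then lamGen k (.up i j h) else 0 := by
  have h1 : lamGen k (.up i j h) * idem k i = lamGen k (.up i j h) := by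
    simpa [lamGen] using RingQuot.mkAlgHom_rel k (Rel.up_source (k := k) i j h)
  rw [← h1, mul_assoc, idem_mul_idem]
  split_ifs <;> simp

theorem idem_mul_lamGen_up {i j : Fin n} (h : (i : ℕ) + 1 = j) (a : Fin n) :
    idem k a * lamGen k (.up i j h) = if a = j then lamGen k (.up i j h) else 0 := by
  have h1 : idem k j * lamGen k (.up i j h) = lamGen k (.up i j h) := by
    simpa [lamGen] using RingQuot.mkAlgHom_rel k (Rel.up_target (k := k) i j h)
  rw [← h1, ← mul_assoc, idem_mul_idem]
  split_ifs with h2 <;> simp [h2]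

theorem lamGen_down_mul_idem {i j : Fin n} (h : (i : ℕ) + 1 = j) (a : Fin n) :
    lamGen k (.down i j h) * idem k a = if j = a then lamGen k (.down i j h) else 0 := by
  have h1 : lamGen k (.down i j h) * idem k j = lamGen k (.down i j h) := by
    simpa [lamGen] using RingQuot.mkAlgHom_rel k (Rel.down_source (k := k) i j h)
  rw [← h1, mul_assoc, idem_mul_idem]
  split_ifs <;> simp

theorem idem_mul_lamGen_down {i j : Fin n} (h : (i : ℕ) + 1 = j) (a : Fin n) :
    idem k a * lamGen k (.down i j h) = if a = i then lamGen k (.down i j h) else 0 := by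
  have h1 : idem k i * lamGen k (.down i j h) = lamGen k (.down i j h) := by
    simpa [lamGen] using RingQuot.mkAlgHom_rel k (Rel.down_target (k := k) i j h)
  rw [← h1, ← mul_assoc, idem_mul_idem]
  split_ifs with h2 <;> simp [h2]

theorem raise_mul_idem {i j : Fin n} (h : (i : ℕ) + 1 = j) :
    raise k n * idem k i = lamGen k (.up i j h) := by
  rw [raise, Finset.sum_mul, Finset.sum_eq_single i, Finset.sum_mul, Finset.sum_eq_single j]
  · simp [h, lamGen_up_mul_idem]
  · intro b _ hb
    rw [dif_neg (fun h' => hb (Fin.ext (h'.symm.trans h))), zero_mul]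
  · simp
  · intro b _ hb
    rw [Finset.sum_mul]
    refine Finset.sum_eq_zero fun c _ => ?_
    split_ifs <;> simp [lamGen_up_mul_idem, hb]
  · simp

theorem idem_mul_raise {i j : Fin n} (h : (i : ℕ) + 1 = j) :
    idem k j * raise k n = lamGen k (.up i j h) := by
  rw [raise, Finset.mul_sum, Finset.sum_eq_single i, Finset.mul_sum, Finset.sum_eq_single j]
  · simp [h, idem_mul_lamGen_up]
  · intro b _ hb
    rw [dif_neg (fun h' => hb (Fin.ext (h'.symm.trans h))), mul_zero]
  · simp
  · intro b _ hb
    rw [Finset.mul_sum]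
    refine Finset.sum_eq_zero fun c _ => ?_
    split_ifs with hc
    · have : j ≠ c := by rintro rfl; exact hb (Fin.ext (by omega))
      simp [idem_mul_lamGen_up, this]
    · simp
  · simp

theorem idem_mul_raise_of_val_eq_zero {i : Fin n} (h : (i : ℕ) = 0) :
    idem k i * raise k n = 0 := by
  simp only [raise, Finset.mul_sum]
  refine Finset.sum_eq_zero fun a _ => Finset.sum_eq_zero fun b _ => ?_
  split_ifs with hc
  · have : i ≠ b := by rintro rfl; omega
    simp [idem_mul_lamGen_up, this]
  · simp

theorem lower_mul_idem {i j : Fin n} (h : (i : ℕ) + 1 = j) :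
    lower k n * idem k j = lamGen k (.down i j h) := by
  rw [lower, Finset.sum_mul, Finset.sum_eq_single i, Finset.sum_mul, Finset.sum_eq_single j]
  · simp [h, lamGen_down_mul_idem]
  · intro b _ hb
    rw [dif_neg (fun h' => hb (Fin.ext (h'.symm.trans h))), zero_mul]
  · simp
  · intro b _ hb
    rw [Finset.sum_mul]
    refine Finset.sum_eq_zero fun c _ => ?_
    split_ifs with hc
    · have : c ≠ j := by rintro rfl; exact hb (Fin.ext (by omega))
      simp [lamGen_down_mul_idem, this]
    · simp
  · simp

theorem idem_mul_lower {i j : Fin n} (h : (i : ℕ) + 1 = j) :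
    idem k i * lower k n = lamGen k (.down i j h) := by
  rw [lower, Finset.mul_sum, Finset.sum_eq_single i, Finset.mul_sum, Finset.sum_eq_single j]
  · simp [h, idem_mul_lamGen_down]
  · intro b _ hb
    rw [dif_neg (fun h' => hb (Fin.ext (h'.symm.trans h))), mul_zero]
  · simp
  · intro b _ hb
    rw [Finset.mul_sum]
    refine Finset.sum_eq_zero fun c _ => ?_
    split_ifs <;> simp [idem_mul_lamGen_down, hb.symm]
  · simp

theorem idem_mul_lower_of_last {i : Fin n} (h : (i : ℕ) + 1 = n) :
    idem k i * lower k n = 0 := by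
  simp only [lower, Finset.mul_sum]
  refine Finset.sum_eq_zero fun a _ => Finset.sum_eq_zero fun b _ => ?_
  split_ifs with hc
  · have : i ≠ a := by rintro rfl; omega
    simp [idem_mul_lamGen_down, this]
  · simp

variable (n) in
theorem raise_mul_raise : raise k n * raise k n = 0 := by
  simp only [raise, Finset.mul_sum, Finset.sum_mul]
  refine Finset.sum_eq_zero fun a _ => Finset.sum_eq_zero fun b _ =>
    Finset.sum_eq_zero fun c _ => Finset.sum_eq_zero fun d _ => ?_
  split_ifs with h1 h2
  · by_cases hd : b = c
    · subst hd
      simpa [lamGen] using RingQuot.mkAlgHom_rel k (Rel.up_up (k := k) a b d h2 h1)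
    · rw [← raise_mul_idem k h1, ← idem_mul_raise k h2, mul_assoc, ← mul_assoc (idem k c),
        idem_mul_idem, if_neg (Ne.symm hd)]
      simp
  all_goals simp

variable (n) in
theorem lower_mul_lower : lower k n * lower k n = 0 := by
  simp only [lower, Finset.mul_sum, Finset.sum_mul]
  refine Finset.sum_eq_zero fun a _ => Finset.sum_eq_zero fun b _ =>
    Finset.sum_eq_zero fun c _ => Finset.sum_eq_zero fun d _ => ?_
  split_ifs with h1 h2
  · by_cases hd : d = a
    · subst hd
      simpa [lamGen] using RingQuot.mkAlgHom_rel k (Rel.down_down (k := k) c d b h1 h2)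
    · rw [← lower_mul_idem k h1, ← idem_mul_lower k h2, mul_assoc, ← mul_assoc (idem k d),
        idem_mul_idem, if_neg hd]
      simp
  all_goals simp

variable (n) in
theorem raise_mul_lower : raise k n * lower k n = 0 := by
  simp only [raise, lower, Finset.mul_sum, Finset.sum_mul]
  refine Finset.sum_eq_zero fun a _ => Finset.sum_eq_zero fun b _ =>
    Finset.sum_eq_zero fun c _ => Finset.sum_eq_zero fun d _ => ?_
  split_ifs with h1 h2
  · by_cases hd : a = c
    · subst hd
      obtain rfl : b = d := Fin.ext (h2.symm.trans h1)
      simpa [lamGen] using RingQuot.mkAlgHom_rel k (Rel.up_down (k := k) a b h1)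
    · rw [← raise_mul_idem k h1, ← idem_mul_lower k h2, mul_assoc, ← mul_assoc (idem k c),
        idem_mul_idem, if_neg (Ne.symm hd)]
      simp
  all_goals simp

end Generators

/-! ### Modules as graded spaces with two differentials -/

section Modules

variable {k : Type u} [Field k] {n : ℕ}

section Action

variable {M : Type*} [AddCommGroup M] [Module (Lam k n) M]

theorem idem_smul_idem_smul (i j : Fin n) (x : M) :
    idem k i • idem k j • x = if i = j then idem k i • x else 0 := by
  rw [smul_smul, idem_mul_idem]
  split_ifs <;> simp

theorem idem_smul_of_ne {i j : Fin n} (hij : i ≠ j) {x : M} (hx : idem k j • x = x) :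
    idem k i • x = 0 := by
  rw [← hx, idem_smul_idem_smul, if_neg hij]

theorem sum_idem_smul (x : M) : ∑ i : Fin n, idem k i • x = x := by
  rw [← Finset.sum_smul, sum_idem, one_smul]

theorem idem_smul_raise_smul {i j : Fin n} (h : (i : ℕ) + 1 = j) (x : M) :
    idem k j • raise k n • x = raise k n • idem k i • x := by
  rw [smul_smul, smul_smul, idem_mul_raise k h, raise_mul_idem k h]

theorem idem_smul_lower_smul {i j : Fin n} (h : (i : ℕ) + 1 = j) (x : M) :
    idem k i • lower k n • x = lower k n • idem k j • x := by
  rw [smul_smul, smul_smul, idem_mul_lower k h, lower_mul_idem k h]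

theorem raise_smul_raise_smul (x : M) : raise k n • raise k n • x = 0 := by
  rw [smul_smul, raise_mul_raise, zero_smul]

theorem lower_smul_lower_smul (x : M) : lower k n • lower k n • x = 0 := by
  rw [smul_smul, lower_mul_lower, zero_smul]

theorem raise_smul_lower_smul (x : M) : raise k n • lower k n • x = 0 := by
  rw [smul_smul, raise_mul_lower, zero_smul]

end Action

variable (k) in
/-- `M` has nonzero homology at the vertex `i` with respect to the arrows `α`, that is, of
`⋯ → M_{i-1} → M_i → M_{i+1} → ⋯`. A boundary in `M_i` is the image of its preimage's component at
`i - 1`, so `s` may range over all of `M`. -/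
def RaiseHomologyAt (M : Type*) [AddCommGroup M] [Module (Lam k n) M] (i : Fin n) : Prop :=
  ∃ t : M, idem k i • t = t ∧ raise k n • t = 0 ∧ ∀ s : M, raise k n • s ≠ t

variable (k) in
/-- `M` has nonzero homology at the vertex `i` with respect to the arrows `α'`, that is, of
`⋯ → M_{i+1} → M_i → M_{i-1} → ⋯`. As for `RaiseHomologyAt`, `s` may range over all of `M`. -/
def LowerHomologyAt (M : Type*) [AddCommGroup M] [Module (Lam k n) M] (i : Fin n) : Prop :=
  ∃ t : M, idem k i • t = t ∧ lower k n • t = 0 ∧ ∀ s : M, lower k n • s ≠ t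

variable {M N : Type*} [AddCommGroup M] [Module (Lam k n) M] [AddCommGroup N] [Module (Lam k n) N]
  [Module k M] [IsScalarTower k (Lam k n) M] [Module k N] [IsScalarTower k (Lam k n) N]

/-- A `k`-linear map commuting with the trivial paths and the arrows is `Λ_n`-linear. -/
def linearMapOfGen (f : M →ₗ[k] N) (hf : ∀ (g : Gen n) x, f (lamGen k g • x) = lamGen k g • f x) :
    M →ₗ[Lam k n] N where
  toFun := f
  map_add' := f.map_add
  map_smul' a x := by
    obtain ⟨a, rfl⟩ := RingQuot.mkAlgHom_surjective k (Rel k n) a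
    induction a using FreeAlgebra.induction generalizing x with
    | grade0 r => simp
    | grade1 g => exact hf g x
    | mul a b ha hb => rw [map_mul, mul_smul, ha, hb, RingHom.id_apply, RingHom.id_apply,
        RingHom.id_apply, mul_smul]
    | add a b ha hb => rw [map_add, add_smul, map_add, ha, hb, RingHom.id_apply, RingHom.id_apply,
        RingHom.id_apply, add_smul]

end Modules

/-! ### Homomorphisms from standard and to costandard modules -/

section StandardMaps

variable (k : Type u) [Field k] {n : ℕ}

/-- The underlying space of `Δ(i)`, with its structures of a `k`-module and of a `Λ_n`-module. -/
def StandardSpace (i : Fin n) : Type u := Supp i → k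

/-- The underlying space of `∇(i)`, with its structures of a `k`-module and of a `Λ_n`-module. -/
def CostandardSpace (i : Fin n) : Type u := Supp i → k

instance (i : Fin n) : AddCommGroup (StandardSpace k i) :=
  inferInstanceAs (AddCommGroup (Supp i → k))

instance (i : Fin n) : Module k (StandardSpace k i) := inferInstanceAs (Module k (Supp i → k))

noncomputable instance (i : Fin n) : Module (Lam k n) (StandardSpace k i) :=
  Module.compHom (Supp i → k) (standardHom k i).toRingHom

instance (i : Fin n) : AddCommGroup (CostandardSpace k i) :=
  inferInstanceAs (AddCommGroup (Supp i → k))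

instance (i : Fin n) : Module k (CostandardSpace k i) := inferInstanceAs (Module k (Supp i → k))

noncomputable instance (i : Fin n) : Module (Lam k n) (CostandardSpace k i) :=
  Module.compHom (Supp i → k) (costandardHom k i).toRingHom

instance (i : Fin n) : IsScalarTower k (Lam k n) (StandardSpace k i) where
  smul_assoc c a v := by
    change standardHom k i (c • a) (show Supp i → k from v) = c • standardHom k i a v
    rw [map_smul]
    rfl

instance (i : Fin n) : IsScalarTower k (Lam k n) (CostandardSpace k i) where
  smul_assoc c a v := by
    change costandardHom k i (c • a) (show Supp i → k from v) = c • costandardHom k i a v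
    rw [map_smul]
    rfl

variable {k}

theorem lamGen_smul_standardSpace {i : Fin n} (g : Gen n) (v : StandardSpace k i) :
    lamGen k g • v = standardGen k i g v := by
  change standardHom k i (lamGen k g) (v : Supp i → k) = _
  rw [standardHom, lamGen, RingQuot.liftAlgHom_mkAlgHom_apply, FreeAlgebra.lift_ι_apply]

theorem lamGen_smul_costandardSpace {i : Fin n} (g : Gen n) (v : CostandardSpace k i) :
    lamGen k g • v = costandardGen k i g v := by
  change costandardHom k i (lamGen k g) (v : Supp i → k) = _
  rw [costandardHom, lamGen, RingQuot.liftAlgHom_mkAlgHom_apply, FreeAlgebra.lift_ι_apply]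

variable {M : Type*} [AddCommGroup M] [Module k M]

theorem sum_unitMap_smul {i : Fin n} (a b : Fin n) (v : Supp i → k) (y : Supp i → M) :
    ∑ c, unitMap k i a b v c • y c =
      if h : (a = i ∨ (a : ℕ) + 1 = i) ∧ (b = i ∨ (b : ℕ) + 1 = i) then
        v ⟨a, h.1⟩ • y ⟨b, h.2⟩ else 0 := by
  split_ifs with h
  · rw [Finset.sum_eq_single ⟨b, h.2⟩]
    · simp [unitMap_apply, h.1]
    · intro c _ hc
      rw [unitMap_apply, dif_neg (fun h' => hc (Subtype.ext h'.1)), zero_smul]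
    · simp
  · refine Finset.sum_eq_zero fun c _ => ?_
    rw [unitMap_apply, dif_neg, zero_smul]
    rintro ⟨rfl, h'⟩
    exact h ⟨h', c.2⟩

variable [Module (Lam k n) M] [IsScalarTower k (Lam k n) M]

/-- The map `Δ(i) → M` with `v ↦ v_i t + v_{i-1} α' t` commutes with trivial paths and arrows. -/
theorem sum_standardGen_smul {i : Fin n} {t : M} (ht : idem k i • t = t)
    (hu : raise k n • t = 0) (g : Gen n) (v : Supp i → k) :
    ∑ c, standardGen k i g v c • (if c.1 = i then t else lower k n • t) =
      lamGen k g • ∑ c, v c • if c.1 = i then t else lower k n • t := by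
  set y : Supp i → M := fun c => if c.1 = i then t else lower k n • t with hy
  have he (a : Fin n) (c : Supp i) : idem k a • y c = if c.1 = a then y c else 0 := by
    by_cases hc : c.1 = i
    · simp only [hy, hc, if_true]
      by_cases ha : i = a
      · subst ha; simp [ht]
      · rw [if_neg ha, idem_smul_of_ne (Ne.symm ha) ht]
    · have h := c.2.resolve_left hc
      have h' : idem k c.1 • y c = y c := by
        simp only [hy, hc, if_false]
        rw [idem_smul_lower_smul h, ht]
      by_cases ha : c.1 = a
      · subst ha; simp [h']
      · rw [if_neg ha, idem_smul_of_ne (Ne.symm ha) h']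
  have hU (c : Supp i) : raise k n • y c = 0 := by
    by_cases hc : c.1 = i <;> simp [hy, hc, hu, raise_smul_lower_smul]
  change ∑ c, standardGen k i g v c • y c = lamGen k g • ∑ c, v c • y c
  rw [Finset.smul_sum]
  simp only [smul_comm (lamGen k g)]
  cases g with
  | e a =>
    simp only [standardGen, sum_unitMap_smul, he]
    split_ifs with h
    · rw [Finset.sum_eq_single ⟨a, h.1⟩]
      · simp
      · intro c _ hc
        rw [if_neg (fun h' => hc (Subtype.ext h')), smul_zero]
      · simp
    · symm
      refine Finset.sum_eq_zero fun c _ => ?_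
      rw [if_neg, smul_zero]
      rintro rfl
      exact h ⟨c.2, c.2⟩
  | up a b h =>
    simp [standardGen, ← idem_mul_raise k h, mul_smul, hU]
  | down a b h =>
    simp only [standardGen, ← lower_mul_idem k h, mul_smul, he]
    by_cases hb : b = i
    · subst hb
      rw [if_pos rfl, sum_unitMap_smul, dif_pos ⟨Or.inl rfl, Or.inr h⟩,
        Finset.sum_eq_single ⟨b, Or.inl rfl⟩]
      · have : a ≠ b := by rintro rfl; omega
        simp [hy, this]
      · intro c _ hc
        rw [if_neg (fun h' => hc (Subtype.ext h')), smul_zero, smul_zero]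
      · simp
    · rw [if_neg hb]
      simp only [LinearMap.zero_apply, Pi.zero_apply, zero_smul, Finset.sum_const_zero]
      symm
      refine Finset.sum_eq_zero fun c _ => ?_
      split_ifs with hc
      · simp only [hy]
        rw [if_neg (by rwa [hc]), lower_smul_lower_smul, smul_zero]
      · simp

/-- An element `t` of `M_i` killed by the arrows `α` is the image of the generator under a
homomorphism `Δ(i) → M`. -/
noncomputable def standardDesc (i : Fin n) (t : M) (ht : idem k i • t = t)
    (hu : raise k n • t = 0) : StandardSpace k i →ₗ[Lam k n] M :=
  -- `id` fixes the module structures on the underlying function space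
  linearMapOfGen (M := StandardSpace k i)
    (id (α := StandardSpace k i →ₗ[k] M) <|
      Fintype.linearCombination k fun c : Supp i => if c.1 = i then t else lower k n • t) <| by
    intro g v
    rw [lamGen_smul_standardSpace]
    exact sum_standardGen_smul ht hu g v

theorem standardDesc_apply {i : Fin n} {t : M} (ht : idem k i • t = t)
    (hu : raise k n • t = 0) (v : StandardSpace k i) :
    standardDesc i t ht hu v =
      ∑ c : Supp i, (v : Supp i → k) c • if c.1 = i then t else lower k n • t := rfl

omit [IsScalarTower k (Lam k n) M] in
/-- The map `M → ∇(i)` with components `x ↦ φ(x)` at `i` and `x ↦ φ(α x)` at `i - 1` commutes with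
trivial paths and arrows. -/
theorem costandardGen_apply {i : Fin n} {φ : M →ₗ[k] k} (he : ∀ x, φ (idem k i • x) = φ x)
    (hd : ∀ x, φ (lower k n • x) = 0) (g : Gen n) (x : M) (c : Supp i) :
    (if c.1 = i then φ (lamGen k g • x) else φ (raise k n • lamGen k g • x)) =
      costandardGen k i g (fun c : Supp i => if c.1 = i then φ x else φ (raise k n • x)) c := by
  have he' (a : Fin n) (ha : a ≠ i) (x : M) : φ (idem k a • x) = 0 := by
    rw [← he, idem_smul_idem_smul, if_neg (Ne.symm ha), map_zero]
  have hr (hc : c.1 ≠ i) (a : Fin n) :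
      φ (raise k n • idem k a • x) = if c.1 = a then φ (raise k n • x) else 0 := by
    rw [← he, idem_smul_raise_smul (c.2.resolve_left hc), idem_smul_idem_smul]
    split_ifs
    · rw [← idem_smul_raise_smul (c.2.resolve_left hc), he]
    · simp
  cases g with
  | e a =>
    rw [costandardGen, unitMap_apply]
    by_cases hc : c.1 = i
    · by_cases ha : a = i
      · subst ha; simp [hc, he]
      · rw [if_pos hc, he' a ha, dif_neg (fun h => ha (h.1.symm.trans hc))]
    · rw [if_neg hc, hr hc]
      by_cases ha : c.1 = a
      · rw [dif_pos ⟨ha, ha ▸ c.2⟩]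
        simp [ha, ha ▸ hc]
      · rw [dif_neg (fun h => ha h.1), if_neg ha]
  | up a b h =>
    simp only [costandardGen, ← raise_mul_idem k h, mul_smul, raise_smul_raise_smul, map_zero]
    by_cases hb : b = i
    · subst hb
      have hab : a ≠ b := by rintro rfl; omega
      rw [if_pos rfl, unitMap_apply]
      by_cases hc : c.1 = b
      · rw [if_pos hc, dif_pos ⟨hc, Or.inr h⟩, if_neg hab, ← idem_smul_raise_smul h, he]
      · rw [if_neg hc, dif_neg (fun h => hc h.1)]
    · rw [if_neg hb, ← idem_smul_raise_smul h, he' b hb]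
      simp
  | down a b h =>
    simp [costandardGen, ← lower_mul_idem k h, mul_smul, raise_smul_lower_smul, hd]

/-- A functional on `M_i` that vanishes on the image of the arrows `α'` gives a homomorphism
`M → ∇(i)`. -/
noncomputable def costandardLift (i : Fin n) (φ : M →ₗ[k] k) (he : ∀ x, φ (idem k i • x) = φ x)
    (hd : ∀ x, φ (lower k n • x) = 0) : M →ₗ[Lam k n] CostandardSpace k i :=
  linearMapOfGen (N := CostandardSpace k i)
    (id (α := M →ₗ[k] CostandardSpace k i) <| show M →ₗ[k] (Supp i → k) from
      { toFun x c := if c.1 = i then φ x else φ (raise k n • x)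
        map_add' x y := by ext c; by_cases hc : c.1 = i <;> simp [hc]
        map_smul' r x := by ext c; by_cases hc : c.1 = i <;> simp [hc, smul_comm _ r x] }) <| by
    intro g x
    rw [lamGen_smul_costandardSpace]
    funext c
    exact costandardGen_apply he hd g x c

theorem costandardLift_apply {i : Fin n} {φ : M →ₗ[k] k} (he : ∀ x, φ (idem k i • x) = φ x)
    (hd : ∀ x, φ (lower k n • x) = 0) (x : M) (c : Supp i) :
    (costandardLift i φ he hd x : Supp i → k) c =
      if c.1 = i then φ x else φ (raise k n • x) := rfl

end StandardMaps

/-! ### Homology of projective and injective modules -/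

section Uniserial

variable (k : Type u) [Field k] {n : ℕ}

/-- The action of the trivial paths and arrows on the uniserial module with composition factors
`L(l)`, `L(i)`, `L(l)`, where `i = l + 1`, in a basis running from the top to the socle. -/
def uniserialGen (l i : Fin n) : Gen n → Matrix (Fin 3) (Fin 3) k
  | .e a => Matrix.diagonal
      ![if a = l then 1 else 0, if a = i then 1 else 0, if a = l then 1 else 0]
  | .up _ b _ => if b = i then !![0, 0, 0; 1, 0, 0; 0, 0, 0] else 0
  | .down _ b _ => if b = i then !![0, 0, 0; 0, 0, 0; 0, 1, 0] else 0

theorem uniserialGen_rel {l i : Fin n} (hl : (l : ℕ) + 1 = i) ⦃x y : FreeAlgebra k (Gen n)⦄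
    (h : Rel k n x y) :
    FreeAlgebra.lift k (uniserialGen k l i) x = FreeAlgebra.lift k (uniserialGen k l i) y := by
  have hli : l ≠ i := by rintro rfl; omega
  have key {a b : Fin n} (h : (a : ℕ) + 1 = b) (hb : b = i) : a = l :=
    Fin.ext (by subst hb; omega)
  cases h with
  | sum_e =>
    simp only [map_sum, FreeAlgebra.lift_ι_apply, uniserialGen, map_one]
    ext a b
    rw [Matrix.sum_apply]
    fin_cases a <;> fin_cases b <;> simp
  | e_mul_e a b =>
    by_cases hab : a = b
    · subst hab
      simp only [map_mul, FreeAlgebra.lift_ι_apply, uniserialGen, if_true,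
        Matrix.diagonal_mul_diagonal]
      congr 1
      funext c
      fin_cases c <;> simp
    · simp only [map_mul, FreeAlgebra.lift_ι_apply, uniserialGen, if_neg hab,
        Matrix.diagonal_mul_diagonal, map_zero, Matrix.diagonal_eq_zero]
      funext c
      fin_cases c <;> simp <;> grind
  | up_source a b h =>
    by_cases hb : b = i
    · have ha := key h hb
      simp only [map_mul, FreeAlgebra.lift_ι_apply, uniserialGen, if_pos hb, ha]
      ext c d; fin_cases c <;> fin_cases d <;> simp
    · simp [uniserialGen, hb]
  | up_target a b h =>
    by_cases hb : b = i
    · simp only [map_mul, FreeAlgebra.lift_ι_apply, uniserialGen, hb, if_true]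
      ext c d; fin_cases c <;> fin_cases d <;> simp
    · simp [uniserialGen, hb]
  | down_source a b h =>
    by_cases hb : b = i
    · simp only [map_mul, FreeAlgebra.lift_ι_apply, uniserialGen, hb, if_true]
      ext c d; fin_cases c <;> fin_cases d <;> simp
    · simp [uniserialGen, hb]
  | down_target a b h =>
    by_cases hb : b = i
    · have ha := key h hb
      simp only [map_mul, FreeAlgebra.lift_ι_apply, uniserialGen, if_pos hb, ha]
      ext c d; fin_cases c <;> fin_cases d <;> simp
    · simp [uniserialGen, hb]
  | up_up a b c h h' =>
    by_cases hb : b = i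
    · have hc : c ≠ i := by rintro rfl; subst hb; omega
      simp [uniserialGen, hc]
    · simp [uniserialGen, hb]
  | down_down a b c h h' =>
    by_cases hb : b = i
    · have hc : c ≠ i := by rintro rfl; subst hb; omega
      simp [uniserialGen, hc]
    · simp [uniserialGen, hb]
  | up_down a b h =>
    by_cases hb : b = i
    · simp only [map_mul, FreeAlgebra.lift_ι_apply, uniserialGen, if_pos hb, map_zero]
      ext c d; fin_cases c <;> fin_cases d <;> simp
    · simp [uniserialGen, hb]

/-- The representation of `Λ_n` on the uniserial module with composition factors
`L(l)`, `L(i)`, `L(l)`. -/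
noncomputable def uniserialHom {l i : Fin n} (hl : (l : ℕ) + 1 = i) :
    Lam k n →ₐ[k] Matrix (Fin 3) (Fin 3) k :=
  RingQuot.liftAlgHom k ⟨FreeAlgebra.lift k (uniserialGen k l i), uniserialGen_rel k hl⟩

/-- The uniserial module with composition factors `L(l)`, `L(i)`, `L(l)` from top to socle, where
`i = l + 1`. It contains `Δ(i)` with quotient `L(l)`, and has `∇(i)` as a quotient with kernel
`L(l)`. -/
def UniserialSpace {l i : Fin n} (_ : (l : ℕ) + 1 = i) : Type u := Fin 3 → k

variable {l i : Fin n} (hl : (l : ℕ) + 1 = i)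

instance : AddCommGroup (UniserialSpace k hl) := inferInstanceAs (AddCommGroup (Fin 3 → k))

instance : Module k (UniserialSpace k hl) := inferInstanceAs (Module k (Fin 3 → k))

noncomputable instance : Module (Lam k n) (UniserialSpace k hl) :=
  Module.compHom (Fin 3 → k)
    ((Matrix.toLinAlgEquiv' : Matrix (Fin 3) (Fin 3) k ≃ₐ[k] _).toAlgHom.comp
      (uniserialHom k hl)).toRingHom

theorem smul_uniserialSpace (a : Lam k n) (v : UniserialSpace k hl) :
    a • v = (uniserialHom k hl a).mulVec v := rfl

instance : IsScalarTower k (Lam k n) (UniserialSpace k hl) where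
  smul_assoc c a v := by
    rw [smul_uniserialSpace, smul_uniserialSpace, map_smul]
    exact Matrix.smul_mulVec c (uniserialHom k hl a) (show Fin 3 → k from v)

theorem uniserialHom_lamGen (g : Gen n) : uniserialHom k hl (lamGen k g) = uniserialGen k l i g := by
  rw [uniserialHom, lamGen, RingQuot.liftAlgHom_mkAlgHom_apply, FreeAlgebra.lift_ι_apply]

theorem uniserialHom_raise : uniserialHom k hl (raise k n) = !![0, 0, 0; 1, 0, 0; 0, 0, 0] := by
  simp only [raise, map_sum]
  rw [Finset.sum_eq_single l, Finset.sum_eq_single i]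
  · simp [hl, uniserialHom_lamGen, uniserialGen]
  · intro b _ hb
    split_ifs <;> simp [uniserialHom_lamGen, uniserialGen, hb]
  · simp
  · intro b _ hb
    refine Finset.sum_eq_zero fun c _ => ?_
    split_ifs with hc
    · have : c ≠ i := by rintro rfl; exact hb (Fin.ext (by omega))
      simp [uniserialHom_lamGen, uniserialGen, this]
    · simp
  · simp

theorem uniserialHom_lower : uniserialHom k hl (lower k n) = !![0, 0, 0; 0, 0, 0; 0, 1, 0] := by
  simp only [lower, map_sum]
  rw [Finset.sum_eq_single l, Finset.sum_eq_single i]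
  · simp [hl, uniserialHom_lamGen, uniserialGen]
  · intro b _ hb
    split_ifs <;> simp [uniserialHom_lamGen, uniserialGen, hb]
  · simp
  · intro b _ hb
    refine Finset.sum_eq_zero fun c _ => ?_
    split_ifs with hc
    · have : c ≠ i := by rintro rfl; exact hb (Fin.ext (by omega))
      simp [uniserialHom_lamGen, uniserialGen, this]
    · simp
  · simp

namespace UniserialSpace

variable {k hl}

/-- The element with the given coordinates, listed from the top to the socle. -/
def mk (v : Fin 3 → k) : UniserialSpace k hl := v

/-- The coordinates with respect to the basis from the top to the socle. -/
def coord (c : Fin 3) : UniserialSpace k hl →ₗ[k] k :=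
  LinearMap.proj (R := k) (φ := fun _ : Fin 3 => k) c

theorem coord_mk (v : Fin 3 → k) (c : Fin 3) : coord c (mk v : UniserialSpace k hl) = v c := rfl

theorem ext {v w : UniserialSpace k hl} (h : ∀ c, coord c v = coord c w) : v = w := funext h

theorem coord_smul (a : Lam k n) (v : UniserialSpace k hl) (c : Fin 3) :
    coord c (a • v) = ∑ d, uniserialHom k hl a c d * coord d v := rfl

theorem coord_idem_smul (v : UniserialSpace k hl) : coord 1 (idem k i • v) = coord 1 v := by
  rw [coord_smul, uniserialHom_lamGen]
  simp [uniserialGen, Matrix.diagonal_apply]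

theorem coord_raise_smul (v : UniserialSpace k hl) (c : Fin 3) :
    coord c (raise k n • v) = if c = 1 then coord 0 v else 0 := by
  rw [coord_smul, uniserialHom_raise]
  fin_cases c <;> simp [Fin.sum_univ_three]

theorem coord_lower_smul (v : UniserialSpace k hl) (c : Fin 3) :
    coord c (lower k n • v) = if c = 2 then coord 1 v else 0 := by
  rw [coord_smul, uniserialHom_lower]
  fin_cases c <;> simp [Fin.sum_univ_three]

end UniserialSpace

end Uniserial

section Homology

variable {k : Type u} [Field k] {n : ℕ}

section

variable {M : Type*} [AddCommGroup M] [Module (Lam k n) M]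

theorem exists_idem_smul_lower_smul (i : Fin n) (x : M) :
    ∃ y : M, idem k i • lower k n • x = lower k n • y := by
  by_cases h : (i : ℕ) + 1 = n
  · exact ⟨0, by rw [smul_smul, idem_mul_lower_of_last k h]; simp⟩
  · exact ⟨idem k ⟨i + 1, by omega⟩ • x, idem_smul_lower_smul (by simp) x⟩

/-- A functional on `M_i` vanishing on the image of the arrows `α'`, but not on `t`. -/
theorem exists_functional [Module k M] [IsScalarTower k (Lam k n) M] {i : Fin n} {t : M}
    (ht : idem k i • t = t) (hs : ∀ s : M, lower k n • s ≠ t) :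
    ∃ φ : M →ₗ[k] k, φ t = 1 ∧ (∀ x, φ (idem k i • x) = φ x) ∧ ∀ x, φ (lower k n • x) = 0 := by
  let L (a : Lam k n) : M →ₗ[k] M := Module.toModuleEnd k M a
  obtain ⟨ψ, hψ, hW⟩ := Submodule.exists_dual_map_eq_bot_of_notMem
    (p := LinearMap.range (L (lower k n))) (x := t) (by rintro ⟨s, h⟩; exact hs s h) inferInstance
  have hW (x : M) : ψ (lower k n • x) = 0 := by
    have : ψ (lower k n • x) ∈ (LinearMap.range (L (lower k n))).map ψ := ⟨_, ⟨x, rfl⟩, rfl⟩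
    simpa [hW] using this
  refine ⟨(ψ t)⁻¹ • ψ ∘ₗ L (idem k i), ?_, fun x => ?_, fun x => ?_⟩
  · change (ψ t)⁻¹ * ψ (idem k i • t) = 1
    rw [ht, inv_mul_cancel₀ hψ]
  · change (ψ t)⁻¹ * ψ (idem k i • idem k i • x) = (ψ t)⁻¹ * ψ (idem k i • x)
    rw [idem_smul_idem_smul, if_pos rfl]
  · change (ψ t)⁻¹ * ψ (idem k i • lower k n • x) = 0
    obtain ⟨y, hy⟩ := exists_idem_smul_lower_smul (k := k) i x
    rw [hy, hW, mul_zero]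

/-- The components of the image of `v` under `Δ(i) → M`. -/
theorem idem_smul_standardDesc [Module k M] [IsScalarTower k (Lam k n) M] {i : Fin n} {t : M}
    (ht : idem k i • t = t) (hu : raise k n • t = 0) (v : StandardSpace k i) (c : Supp i) :
    idem k c.1 • standardDesc i t ht hu v =
      (v : Supp i → k) c • if c.1 = i then t else lower k n • t := by
  refine (sum_standardGen_smul ht hu (.e c.1) v).symm.trans ?_
  refine (sum_unitMap_smul c.1 c.1 (show Supp i → k from v) _).trans ?_
  rw [dif_pos ⟨c.2, c.2⟩]

variable (k) in
/-- The generator of `Δ(i)` at the vertex `i`. -/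
def standardTop (i : Fin n) : StandardSpace k i :=
  (Pi.single (⟨i, Or.inl rfl⟩ : Supp i) (1 : k) : Supp i → k)

theorem standardDesc_standardTop [Module k M] [IsScalarTower k (Lam k n) M] {i : Fin n} {t : M}
    (ht : idem k i • t = t) (hu : raise k n • t = 0) :
    standardDesc i t ht hu (standardTop k i) = t := by
  rw [standardDesc_apply, Finset.sum_eq_single ⟨i, Or.inl rfl⟩]
  · simp [standardTop]
  · intro c _ hc
    rw [standardTop, Pi.single_eq_of_ne hc, zero_smul]
  · simp

theorem standardDesc_injective [Module k M] [IsScalarTower k (Lam k n) M] {i : Fin n} {t : M}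
    (ht : idem k i • t = t) (hu : raise k n • t = 0) (h0 : t ≠ 0)
    (hd : 0 < (i : ℕ) → lower k n • t ≠ 0) : Function.Injective (standardDesc i t ht hu) := by
  rw [injective_iff_map_eq_zero]
  intro v hv
  funext c
  have h := idem_smul_standardDesc ht hu v c
  rw [hv, smul_zero, eq_comm, smul_eq_zero] at h
  refine h.resolve_right ?_
  split_ifs with hc
  · exact h0
  · exact hd (by have := c.2.resolve_left hc; omega)

end

/-- A map from a projective module to `∇(i)` lifts to the uniserial module covering `∇(i)`. -/
theorem not_lowerHomologyAt_of_projective {P : Type u} [AddCommGroup P] [Module (Lam k n) P]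
    [Module k P] [IsScalarTower k (Lam k n) P] [Module.Projective (Lam k n) P] {i : Fin n}
    (hi : 0 < (i : ℕ)) : ¬ LowerHomologyAt k P i := by
  rintro ⟨t, ht, hd, hs⟩
  obtain ⟨φ, hφ, he, hl⟩ := exists_functional ht hs
  obtain ⟨l, hli⟩ : ∃ l : Fin n, (l : ℕ) + 1 = i := ⟨⟨i - 1, by omega⟩, by simp; omega⟩
  let ψ : UniserialSpace k hli →ₗ[k] k := UniserialSpace.coord 1
  have hψd (v : UniserialSpace k hli) : ψ (lower k n • v) = 0 :=
    UniserialSpace.coord_lower_smul v 1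
  have hsurj : Function.Surjective
      (costandardLift i ψ UniserialSpace.coord_idem_smul hψd) := by
    intro w
    refine ⟨UniserialSpace.mk ![(show Supp i → k from w) ⟨l, Or.inr hli⟩,
      (show Supp i → k from w) ⟨i, Or.inl rfl⟩, 0], funext fun c => ?_⟩
    refine (costandardLift_apply _ _ _ c).trans ?_
    rw [UniserialSpace.coord_raise_smul, if_pos rfl, UniserialSpace.coord_mk,
      UniserialSpace.coord_mk]
    obtain ⟨c, rfl | hc⟩ := c
    · simp
    · obtain rfl : c = l := Fin.ext (by omega)
      rw [if_neg (fun h => by have h' : (c : ℕ) = i := congrArg Fin.val h; omega)]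
      simp
  obtain ⟨h, hh⟩ := Module.projective_lifting_property _ (costandardLift i φ he hl) hsurj
  have h1 : ψ (h t) = 1 := by
    have := congrFun (LinearMap.congr_fun hh t : (_ : Supp i → k) = _) ⟨i, Or.inl rfl⟩
    rw [LinearMap.comp_apply, costandardLift_apply, costandardLift_apply, if_pos rfl, if_pos rfl,
      hφ] at this
    exact this
  have h2 := UniserialSpace.coord_lower_smul (h t) 2
  rw [← map_smul, hd, map_zero, map_zero, if_pos rfl] at h2
  exact zero_ne_one (h2.trans h1)

/-- A map from `Δ(i)` to an injective module extends to the uniserial module containing `Δ(i)`. -/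
theorem not_raiseHomologyAt_of_injective {I : Type u} [AddCommGroup I] [Module (Lam k n) I]
    [Module k I] [IsScalarTower k (Lam k n) I] [Module.Injective (Lam k n) I] {i : Fin n}
    (hi : 0 < (i : ℕ)) : ¬ RaiseHomologyAt k I i := by
  rintro ⟨t, ht, hu, hs⟩
  obtain ⟨l, hli⟩ : ∃ l : Fin n, (l : ℕ) + 1 = i := ⟨⟨i - 1, by omega⟩, by simp; omega⟩
  let y : UniserialSpace k hli := .mk ![1, 0, 0]
  let x : UniserialSpace k hli := .mk ![0, 1, 0]
  have hyx : raise k n • y = x := UniserialSpace.ext fun c => by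
    rw [UniserialSpace.coord_raise_smul, UniserialSpace.coord_mk, UniserialSpace.coord_mk]
    fin_cases c <;> simp
  have hx : idem k i • x = x := by
    rw [← hyx, idem_smul_raise_smul hli]
    refine UniserialSpace.ext fun c => ?_
    rw [UniserialSpace.coord_raise_smul, UniserialSpace.coord_raise_smul,
      UniserialSpace.coord_smul, uniserialHom_lamGen]
    simp [uniserialGen, Matrix.diagonal_apply]
  have hux : raise k n • x = 0 := by rw [← hyx, raise_smul_raise_smul]
  have hdx : lower k n • x ≠ 0 := fun h => by
    have := UniserialSpace.coord_lower_smul x 2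
    rw [h, UniserialSpace.coord_mk] at this
    simp at this
  have hx0 : x ≠ 0 := fun h => hdx (by rw [h, smul_zero])
  obtain ⟨h, hh⟩ := Module.Injective.out (standardDesc i x hx hux)
    (standardDesc_injective hx hux hx0 fun _ => hdx) (standardDesc i t ht hu)
  refine hs (h y) ?_
  have := hh (standardTop k i)
  rw [standardDesc_standardTop, standardDesc_standardTop] at this
  rw [← map_smul, hyx, this]

/-! ### Dimension shifting -/

variable {A B C : Type*} [AddCommGroup A] [Module (Lam k n) A] [AddCommGroup B]
  [Module (Lam k n) B] [AddCommGroup C] [Module (Lam k n) C]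
  {f : A →ₗ[Lam k n] B} {g : B →ₗ[Lam k n] C}

/-- Every element of `C_i` lifts to an element of `B_i`. -/
theorem exists_lift_idem (hg : Function.Surjective g) {i : Fin n} {t : C}
    (ht : idem k i • t = t) : ∃ p : B, idem k i • p = p ∧ g p = t := by
  obtain ⟨p, rfl⟩ := hg t
  exact ⟨idem k i • p, by rw [idem_smul_idem_smul, if_pos rfl], by rw [map_smul, ht]⟩

/-- A class in the homology of `C` at `i` with respect to the arrows `α'` that does not come from
`B` has a nonzero connecting class in the homology of `A` at `l = i - 1`. It is represented by the
preimage `x` of `α' p`, where `p` lifts a representative of the class of `C`. -/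
theorem exists_connecting_lower (hf : Function.Injective f) (hfg : Function.Exact f g)
    (hg : Function.Surjective g) {l i : Fin n} (hl : (l : ℕ) + 1 = i)
    (hB : ¬ LowerHomologyAt k B i) (hC : LowerHomologyAt k C i) :
    ∃ (p : B) (x : A), f x = lower k n • p ∧ idem k l • x = x ∧ lower k n • x = 0 ∧
      ∀ s : A, lower k n • s ≠ x := by
  obtain ⟨t, ht, hd, hs⟩ := hC
  obtain ⟨p, hp, rfl⟩ := exists_lift_idem hg ht
  obtain ⟨x, hx⟩ := (hfg (lower k n • p)).1 (by rw [map_smul, hd])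
  refine ⟨p, x, hx, hf ?_, hf ?_, fun s hsx => hB ?_⟩
  · rw [map_smul, hx, idem_smul_lower_smul hl, hp]
  · rw [map_smul, hx, lower_smul_lower_smul, map_zero]
  · -- otherwise `p` could be corrected to a cycle, whose image under `g` is still `t`
    have h1 : idem k l • lower k n • s = lower k n • s := by
      rw [hsx]; exact hf (by rw [map_smul, hx, idem_smul_lower_smul hl, hp])
    rw [idem_smul_lower_smul hl] at h1
    refine ⟨p - f (idem k i • s), ?_, ?_, fun q hq => hs (g q) ?_⟩
    · rw [smul_sub, hp, ← map_smul, idem_smul_idem_smul, if_pos rfl]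
    · rw [smul_sub, ← map_smul, h1, hsx, hx, sub_self]
    · rw [← map_smul, hq, map_sub, (hfg _).2 ⟨_, rfl⟩, sub_zero]

/-- A class in the homology of `A` at `i` with respect to the arrows `α` that dies in `B` is the
connecting image of a class in the homology of `C` at `l = i - 1`; it is not the image of a cycle
of `B`. -/
theorem exists_connecting_raise (hf : Function.Injective f) (hfg : Function.Exact f g)
    {l i : Fin n} (hl : (l : ℕ) + 1 = i)
    (hB : ¬ RaiseHomologyAt k B i) (hA : RaiseHomologyAt k A i) :
    ∃ c : C, idem k l • c = c ∧ raise k n • c = 0 ∧ ∀ s : B, raise k n • s = 0 → g s ≠ c := by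
  obtain ⟨t, ht, hu, hs⟩ := hA
  obtain ⟨s, h⟩ : ∃ s : B, raise k n • s = f t := by
    by_contra! h
    exact hB ⟨f t, by rw [← map_smul, ht], by rw [← map_smul, hu, map_zero], h⟩
  refine ⟨g (idem k l • s), ?_, ?_, fun r hr hgr => ?_⟩
  · rw [← map_smul, idem_smul_idem_smul, if_pos rfl]
  · rw [← map_smul, ← idem_smul_raise_smul hl, h, ← map_smul, ht, (hfg _).2 ⟨_, rfl⟩]
  · -- `idem k l • s - r` lies in `A`, and the arrows `α` take it to `t`
    obtain ⟨a, ha⟩ := (hfg (idem k l • s - r)).1 (by rw [map_sub, hgr, sub_self])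
    refine hs a (hf ?_)
    rw [map_smul, ha, smul_sub, hr, sub_zero, ← idem_smul_raise_smul hl, h, ← map_smul, ht]

end Homology

/-! ### Nonvanishing of extensions -/

section Ext

variable {k : Type u} [Field k] {n : ℕ}

open scoped ModuleCat
open Abelian

/-- The homomorphism `x ↦ φ(x) c` from a functional `φ` and an element `c` at the first vertex; it
factors through the simple module `L(1) = Δ(1) = ∇(1)`. -/
noncomputable def homOfFunctional {A C : Type*} [AddCommGroup A] [Module (Lam k n) A] [Module k A]
    [IsScalarTower k (Lam k n) A] [AddCommGroup C] [Module (Lam k n) C] [Module k C]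
    [IsScalarTower k (Lam k n) C] {l : Fin n} (hl : (l : ℕ) = 0) (φ : A →ₗ[k] k)
    (he : ∀ x, φ (idem k l • x) = φ x) (hd : ∀ x, φ (lower k n • x) = 0) {c : C}
    (hc : idem k l • c = c) (hu : raise k n • c = 0) : A →ₗ[Lam k n] C :=
  linearMapOfGen (φ.smulRight c) <| by
    have he' (a : Fin n) (ha : a ≠ l) (x : A) : φ (idem k a • x) = 0 := by
      rw [← he, idem_smul_idem_smul, if_neg (Ne.symm ha), map_zero]
    intro g x
    simp only [LinearMap.smulRight_apply]
    rw [smul_comm (lamGen k g)]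
    cases g with
    | e a =>
      by_cases ha : a = l
      · subst ha; rw [he, hc]
      · rw [he' a ha, idem_smul_of_ne ha hc]; simp
    | up a b h =>
      have hb : b ≠ l := by rintro rfl; omega
      rw [← idem_mul_raise k h, mul_smul, mul_smul, he' b hb, hu]; simp
    | down a b h =>
      have hb : b ≠ l := by rintro rfl; omega
      rw [← lower_mul_idem k h, mul_smul, mul_smul, hd, idem_smul_of_ne hb hc]; simp

theorem exists_projective_shortExact (M : ModuleCat.{u} (Lam k n)) :
    ∃ S : ShortComplex (ModuleCat.{u} (Lam k n)), S.X₃ = M ∧ S.ShortExact ∧ Projective S.X₂ :=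
  ⟨M.projectiveShortComplex, rfl, M.shortExact_projectiveShortComplex,
    (IsProjective.iff_projective M.projectiveShortComplex.X₂).1 inferInstance⟩

theorem exists_injective_shortExact (M : ModuleCat.{u} (Lam k n)) :
    ∃ S : ShortComplex (ModuleCat.{u} (Lam k n)), S.X₁ = M ∧ S.ShortExact ∧ Injective S.X₂ := by
  obtain ⟨I, _, f, _⟩ := EnoughInjectives.presentation M
  have injf : Function.Injective f.hom := (ModuleCat.mono_iff_injective f).mp ‹_›
  exact ⟨ModuleCat.shortComplexOfCompEqZero _ _ f.hom.exact_map_mkQ_range.linearMap_comp_eq_zero,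
    rfl, ModuleCat.shortComplex_shortExact _ f.hom.exact_map_mkQ_range injf
      (Submodule.mkQ_surjective _), ‹_›⟩

variable {S : ShortComplex (ModuleCat.{u} (Lam k n))}

theorem shortExact_function_exact (hS : S.ShortExact) : Function.Exact S.f.hom S.g.hom :=
  (ShortComplex.ShortExact.moduleCat_exact_iff_function_exact S).1 hS.exact

theorem not_lowerHomologyAt_X₂ [Projective S.X₂] {i : Fin n} (hi : 0 < (i : ℕ)) :
    ¬ LowerHomologyAt k S.X₂ i :=
  have : Module.Projective (Lam k n) S.X₂ := (IsProjective.iff_projective S.X₂).2 ‹_›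
  not_lowerHomologyAt_of_projective hi

theorem not_raiseHomologyAt_X₂ [Injective S.X₂] {i : Fin n} (hi : 0 < (i : ℕ)) :
    ¬ RaiseHomologyAt k S.X₂ i :=
  have : Module.Injective (Lam k n) S.X₂ := Module.injective_module_of_injective_object _ _
  not_raiseHomologyAt_of_injective hi

theorem subsingleton_ext_X₁ (hS : S.ShortExact) [Projective S.X₂] (Y : ModuleCat.{u} (Lam k n))
    (m : ℕ) [Subsingleton (Ext S.X₃ Y (m + 2))] : Subsingleton (Ext S.X₁ Y (m + 1)) := by
  refine subsingleton_of_forall_eq 0 fun x => ?_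
  obtain ⟨y, rfl⟩ := Ext.contravariant_sequence_exact₁ hS Y x (n₁ := m + 2) (by omega)
    (Subsingleton.elim _ _)
  rw [Ext.eq_zero_of_projective y, Ext.comp_zero]

theorem subsingleton_ext_X₃ (hS : S.ShortExact) [Injective S.X₂] (X : ModuleCat.{u} (Lam k n))
    (m : ℕ) [Subsingleton (Ext X S.X₁ (m + 2))] : Subsingleton (Ext X S.X₃ (m + 1)) := by
  refine subsingleton_of_forall_eq 0 fun x => ?_
  obtain ⟨y, rfl⟩ := Ext.covariant_sequence_exact₃ X hS x (n₁ := m + 2) (by omega)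
    (Subsingleton.elim _ _)
  rw [Ext.eq_zero_of_injective y, Ext.zero_comp]

/-- The homomorphism `K' → L(1) → C'` between the first syzygy of `M` and the first cosyzygy of `N`
given by the two homology classes represents a nonzero element of `Ext²(M, N)`. -/
theorem nontrivial_ext_two {M N : ModuleCat.{u} (Lam k n)} {i : Fin n} (hi : (i : ℕ) = 1)
    (hM : LowerHomologyAt k M i) (hN : RaiseHomologyAt k N i) : Nontrivial (Ext M N 2) := by
  by_contra h
  rw [not_nontrivial_iff_subsingleton] at h
  obtain ⟨S, rfl, hS, _⟩ := exists_projective_shortExact M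
  obtain ⟨T, rfl, hT, _⟩ := exists_injective_shortExact N
  obtain ⟨l, hl⟩ : ∃ l : Fin n, (l : ℕ) + 1 = i := ⟨⟨i - 1, by omega⟩, by simp; omega⟩
  obtain ⟨p, x, hpx, hx, -, hxs⟩ := exists_connecting_lower hS.moduleCat_injective_f
    (shortExact_function_exact hS) hS.moduleCat_surjective_g hl
    (not_lowerHomologyAt_X₂ (by omega)) hM
  obtain ⟨c, hc, hu, hcs⟩ := exists_connecting_raise hT.moduleCat_injective_f
    (shortExact_function_exact hT) hl (not_raiseHomologyAt_X₂ (by omega)) hN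
  obtain ⟨φ, hφ, he, hd⟩ := exists_functional hx hxs
  let f : S.X₁ ⟶ T.X₃ := ModuleCat.ofHom (homOfFunctional (by omega) φ he hd hc hu)
  have : Subsingleton (Ext S.X₃ T.X₁ (0 + 2)) := h
  have := subsingleton_ext_X₁ hS T.X₁ 0
  obtain ⟨y, hy⟩ := Ext.covariant_sequence_exact₃ S.X₁ hT (Ext.mk₀ f) (n₁ := 0 + 1) rfl
    (Subsingleton.elim _ _)
  obtain ⟨y, rfl⟩ := Ext.addEquiv₀.symm.surjective y
  have hy : y ≫ T.g = f := by
    apply Ext.addEquiv₀.symm.injective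
    simpa using hy
  -- `f` factors as `S.X₁ → S.X₂ → T.X₂ → T.X₃`, and `S.f x` is a boundary `α' p`, which `α` kills
  have := hS.mono_f
  obtain ⟨z, rfl⟩ : ∃ z : S.X₂ ⟶ T.X₂, S.f ≫ z = y :=
    ⟨Injective.factorThru y S.f, Injective.comp_factorThru y S.f⟩
  refine hcs (z.hom (S.f.hom x)) ?_ ?_
  · rw [hpx, map_smul, raise_smul_lower_smul]
  · have := congrArg (fun f => f.hom x) hy
    refine this.trans ?_
    change φ x • c = c
    rw [hφ, one_smul]

/-- Homology of `M` at `j` with respect to the arrows `α'` and homology of `N` at `i` with respect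
to the arrows `α` yield an extension of degree `(i - 1) + (j - 1)` when the vertices are numbered
from `1`. -/
theorem nontrivial_ext_of_homology {M N : ModuleCat.{u} (Lam k n)} {i j : Fin n}
    (hi : 0 < (i : ℕ)) (hj : 0 < (j : ℕ)) (hM : LowerHomologyAt k M j)
    (hN : RaiseHomologyAt k N i) : Nontrivial (Ext M N (i + j)) := by
  obtain ⟨a, ha⟩ := Nat.exists_eq_succ_of_ne_zero hi.ne'
  obtain ⟨b, hb⟩ := Nat.exists_eq_succ_of_ne_zero hj.ne'
  induction b generalizing M j with
  | succ b ih =>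
    by_contra h
    rw [not_nontrivial_iff_subsingleton] at h
    obtain ⟨S, rfl, hS, _⟩ := exists_projective_shortExact M
    obtain ⟨l, hl⟩ : ∃ l : Fin n, (l : ℕ) + 1 = j := ⟨⟨j - 1, by omega⟩, by simp; omega⟩
    obtain ⟨-, x, -, hx⟩ := exists_connecting_lower hS.moduleCat_injective_f
      (shortExact_function_exact hS) hS.moduleCat_surjective_g hl
      (not_lowerHomologyAt_X₂ (by omega)) hM
    have := ih (M := S.X₁) (j := l) (by omega) ⟨x, hx⟩ (by omega)
    rw [show (i : ℕ) + l = (a + b + 1) + 1 by omega] at this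
    rw [show (i : ℕ) + j = (a + b + 1) + 2 by omega] at h
    have : Subsingleton (Ext S.X₃ N (a + b + 1 + 2)) := h
    exact not_subsingleton _ (subsingleton_ext_X₁ hS N (a + b + 1))
  | zero =>
    induction a generalizing N i with
    | succ a ih =>
      by_contra h
      rw [not_nontrivial_iff_subsingleton] at h
      obtain ⟨T, rfl, hT, _⟩ := exists_injective_shortExact N
      obtain ⟨l, hl⟩ : ∃ l : Fin n, (l : ℕ) + 1 = i := ⟨⟨i - 1, by omega⟩, by simp; omega⟩
      obtain ⟨c, hc, hu, hcs⟩ := exists_connecting_raise hT.moduleCat_injective_f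
        (shortExact_function_exact hT) hl (not_raiseHomologyAt_X₂ (by omega)) hN
      have := ih (N := T.X₃) (i := l) (by omega) ⟨c, hc, hu, fun s hs => by
        obtain ⟨r, rfl⟩ := hT.moduleCat_surjective_g s
        exact hcs (raise k n • r) (raise_smul_raise_smul r) (by rw [map_smul, hs])⟩ (by omega)
      rw [show (l : ℕ) + j = (a + 1) + 1 by omega] at this
      rw [show (i : ℕ) + j = (a + 1) + 2 by omega] at h
      exact not_subsingleton _ (subsingleton_ext_X₃ hT M (a + 1))
    | zero =>
      obtain rfl : i = j := Fin.ext (by omega)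
      rw [show (i : ℕ) + i = 2 by omega]
      exact nontrivial_ext_two (by omega) hM hN

end Ext

/-! ### Prolonging filtrations -/

section Filtration

variable {A : Type u} [Ring A] {ι : Type} {S : ι → ModuleCat.{u} A}
  {M : Type u} [AddCommGroup M] [Module A M]

theorem hasFiltration_of_subsingleton [Subsingleton M] : HasFiltration S (ModuleCat.of A M) :=
  ⟨0, fun _ => ⊥, rfl, Subsingleton.elim _ _, fun t ht => absurd ht (Nat.not_lt_zero t)⟩

theorem nonempty_quotient_equiv {P' P : Submodule A M} {Q : Type u} [AddCommGroup Q] [Module A Q]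
    (φ : P →ₗ[A] Q) (hφ : Function.Surjective φ) (hker : ∀ x, φ x = 0 ↔ (x : M) ∈ P')
    {X : ModuleCat.{u} A} (e : Q ≃ₗ[A] X) : Nonempty ((P ⧸ P'.submoduleOf P) ≃ₗ[A] X) := by
  have : P'.submoduleOf P = LinearMap.ker φ := by
    ext x
    exact (hker x).symm
  exact ⟨(Submodule.quotEquivOfEq _ _ this).trans ((φ.quotKerEquivOfSurjective hφ).trans e)⟩

/-- A filtration of `M ⧸ P` can be prolonged at the bottom by `P`. -/
theorem HasFiltration.of_quotient {P : Submodule A M} (i : ι) (e : P ≃ₗ[A] S i)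
    (h : HasFiltration S (ModuleCat.of A (M ⧸ P))) : HasFiltration S (ModuleCat.of A M) := by
  obtain ⟨r, F, h0, hr, hF⟩ := h
  let G (t : ℕ) : Submodule A M := (F t).comap P.mkQ
  refine ⟨r + 1, fun t => Nat.casesOn t ⊥ G, rfl, ?_, fun t ht => ?_⟩
  · change (F r).comap P.mkQ = ⊤
    rw [hr, Submodule.comap_top]
  · cases t with
    | zero =>
      have hG : G 0 = P := by
        change (F 0).comap P.mkQ = P
        rw [h0]; exact P.ker_mkQ
      refine ⟨bot_le, i, ?_⟩
      refine nonempty_quotient_equiv (P' := ⊥) (P := G 0) (LinearEquiv.ofEq _ _ hG).toLinearMap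
        (LinearEquiv.ofEq _ _ hG).surjective (fun x => ?_) e
      simp
    | succ t =>
      obtain ⟨hle, j, ⟨e'⟩⟩ := hF t (by omega)
      refine ⟨Submodule.comap_mono hle, j, ?_⟩
      refine nonempty_quotient_equiv (P' := G t) (P := G (t + 1))
        (((F t).submoduleOf (F (t + 1))).mkQ ∘ₗ
          P.mkQ.restrict (p := G (t + 1)) (q := F (t + 1)) fun _ hx => hx) ?_ (fun x => ?_) e'
      · refine (Submodule.mkQ_surjective _).comp ?_
        rintro ⟨y, hy⟩
        obtain ⟨x, rfl⟩ := P.mkQ_surjective y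
        exact ⟨⟨x, hy⟩, rfl⟩
      · rw [LinearMap.comp_apply, ← LinearMap.mem_ker, Submodule.ker_mkQ]
        rfl

/-- A filtration of the kernel of an epimorphism can be prolonged at the top. -/
theorem HasFiltration.of_ker (i : ι) (g : M →ₗ[A] S i) (hg : Function.Surjective g)
    (h : HasFiltration S (ModuleCat.of A (LinearMap.ker g))) :
    HasFiltration S (ModuleCat.of A M) := by
  obtain ⟨r, F, h0, hr, hF⟩ := h
  let G (t : ℕ) : Submodule A M := (F t).map (LinearMap.ker g).subtype
  have hG : G r = LinearMap.ker g := by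
    change (F r).map (LinearMap.ker g).subtype = _
    rw [hr]; exact (LinearMap.ker g).map_subtype_top
  let H (t : ℕ) : Submodule A M := if t ≤ r then G t else ⊤
  have hH (t : ℕ) (ht : t ≤ r) : H t = G t := if_pos ht
  have hH' : H (r + 1) = ⊤ := if_neg (Nat.not_succ_le_self r)
  refine ⟨r + 1, H, ?_, hH', fun t ht => ?_⟩
  · rw [hH 0 (Nat.zero_le r)]
    change (F 0).map (LinearMap.ker g).subtype = _
    rw [h0]; exact Submodule.map_bot _
  · obtain h' | rfl := Nat.lt_succ_iff_lt_or_eq.1 ht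
    · obtain ⟨hle, j, ⟨e'⟩⟩ := hF t h'
      rw [hH t h'.le, hH (t + 1) h']
      refine ⟨Submodule.map_mono hle, j, ?_⟩
      let e := Submodule.equivMapOfInjective (LinearMap.ker g).subtype
        (LinearMap.ker g).injective_subtype (F (t + 1))
      refine nonempty_quotient_equiv (P' := G t) (P := G (t + 1))
        (((F t).submoduleOf (F (t + 1))).mkQ ∘ₗ e.symm.toLinearMap) ?_ (fun x => ?_) e'
      · exact (Submodule.mkQ_surjective _).comp e.symm.surjective
      · obtain ⟨y, rfl⟩ := e.surjective x
        rw [LinearMap.comp_apply, ← LinearMap.mem_ker, Submodule.ker_mkQ]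
        simp only [LinearEquiv.coe_coe, LinearEquiv.symm_apply_apply]
        constructor
        · exact fun hy => ⟨y, hy, rfl⟩
        · rintro ⟨z, hz, hzy⟩
          obtain rfl : z = y := Subtype.ext hzy
          exact hz
    · rw [hH t le_rfl, hH']
      refine ⟨le_top, i, ?_⟩
      refine nonempty_quotient_equiv (P' := G t) (P := ⊤) (g ∘ₗ (⊤ : Submodule A M).subtype)
        (fun y => ?_) (fun x => ?_) (LinearEquiv.refl A (S i))
      · obtain ⟨x, rfl⟩ := hg y
        exact ⟨⟨x, trivial⟩, rfl⟩
      · rw [hG]; rfl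

end Filtration

/-! ### Splitting off `Δ(m)` and `∇(m)` at the largest vertex -/

section Exact

variable {k : Type u} [Field k] {n : ℕ} {M : Type u} [AddCommGroup M] [Module (Lam k n) M]

/-- A nonzero module has a largest vertex `m` in its support. -/
theorem exists_top_vertex [Nontrivial M] :
    ∃ (m : Fin n) (x : M), x ≠ 0 ∧ idem k m • x = x ∧ ∀ j, m < j → ∀ y : M, idem k j • y = 0 := by
  classical
  obtain ⟨y, hy⟩ := exists_ne (0 : M)
  have hne : (Finset.univ.filter fun i : Fin n => ∃ y : M, idem k i • y ≠ 0).Nonempty := by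
    by_contra! h
    rw [Finset.filter_eq_empty_iff] at h
    refine hy ?_
    rw [← sum_idem_smul (k := k) (n := n) y]
    exact Finset.sum_eq_zero fun i hi => by_contra fun h' => h hi ⟨y, h'⟩
  obtain ⟨m, hm, hmax⟩ := Finset.exists_max_image _ id hne
  obtain ⟨x, hx⟩ := (Finset.mem_filter.1 hm).2
  refine ⟨m, idem k m • x, hx, by rw [idem_smul_idem_smul, if_pos rfl], fun j hj y => ?_⟩
  by_contra hy
  exact absurd (hmax j (Finset.mem_filter.2 ⟨Finset.mem_univ _, y, hy⟩)) (not_le.2 hj)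

variable {m : Fin n} (hm : ∀ j, m < j → ∀ y : M, idem k j • y = 0)
include hm

theorem raise_smul_eq_zero_of_top {x : M} (hx : idem k m • x = x) : raise k n • x = 0 := by
  rw [← sum_idem_smul (k := k) (n := n) (raise k n • x)]
  refine Finset.sum_eq_zero fun j _ => ?_
  by_cases hj : m < j
  · exact hm j hj _
  by_cases h0 : (j : ℕ) = 0
  · rw [smul_smul, idem_mul_raise_of_val_eq_zero k h0, zero_smul]
  · have hl : ((⟨j - 1, by omega⟩ : Fin n) : ℕ) + 1 = j := by simp; omega
    rw [idem_smul_raise_smul hl, idem_smul_of_ne (fun h => hj ?_) hx, smul_zero]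
    rw [Fin.lt_def, ← hl, ← h]
    exact Nat.lt_succ_self _

theorem idem_smul_lower_smul_of_top (x : M) : idem k m • lower k n • x = 0 := by
  by_cases h : (m : ℕ) + 1 = n
  · rw [smul_smul, idem_mul_lower_of_last k h, zero_smul]
  · rw [idem_smul_lower_smul (j := ⟨m + 1, by omega⟩) rfl, hm _ (by simp [Fin.lt_def]), smul_zero]

theorem le_of_idem_smul_ne {i : Fin n} {t : M} (ht : idem k i • t ≠ 0) : i ≤ m :=
  not_lt.1 fun h => ht (hm i h t)

variable [Module k M] [IsScalarTower k (Lam k n) M]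

/-- If the arrows `α'` are exact on `M`, then an element at the largest vertex `m` of its support
generates a copy of `Δ(m)`. -/
theorem standardDesc_injective_of_top (hM : ∀ i : Fin n, 0 < (i : ℕ) → ¬ LowerHomologyAt k M i)
    {x : M} (hx0 : x ≠ 0) (hx : idem k m • x = x) :
    Function.Injective (standardDesc m x hx (raise_smul_eq_zero_of_top hm hx)) := by
  refine standardDesc_injective hx _ hx0 fun h0 hd => hM m h0 ⟨x, hx, hd, fun s hs => hx0 ?_⟩
  rw [← hx, ← hs, idem_smul_lower_smul_of_top hm]

/-- Exactness of the arrows `α'` passes to the quotient by `Δ(m)`. -/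
theorem not_lowerHomologyAt_quotient (hM : ∀ i : Fin n, 0 < (i : ℕ) → ¬ LowerHomologyAt k M i)
    {x : M} (hx : idem k m • x = x) {i : Fin n} (hi : 0 < (i : ℕ)) :
    ¬ LowerHomologyAt k
      (M ⧸ LinearMap.range (standardDesc m x hx (raise_smul_eq_zero_of_top hm hx))) i := by
  have hu := raise_smul_eq_zero_of_top hm hx
  set P := LinearMap.range (standardDesc m x hx hu)
  have hxP : x ∈ P := ⟨standardTop k m, standardDesc_standardTop hx hu⟩
  rintro ⟨t, ht, hd, hs⟩
  obtain ⟨t, ht', rfl⟩ := exists_lift_idem P.mkQ_surjective ht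
  have him : i ≤ m := le_of_idem_smul_ne hm (t := t) fun h => hs 0 (by
    rw [← ht', h, map_zero, smul_zero])
  rw [← map_smul, Submodule.mkQ_apply, Submodule.Quotient.mk_eq_zero] at hd
  obtain ⟨v, hv⟩ := hd
  obtain ⟨l, hl⟩ : ∃ l : Fin n, (l : ℕ) + 1 = i := ⟨⟨i - 1, by omega⟩, by simp; omega⟩
  obtain ⟨r, hr⟩ : ∃ r : k, lower k n • t = r • lower k n • idem k i • x := by
    have h1 : idem k l • lower k n • t = lower k n • t := by rw [idem_smul_lower_smul hl, ht']
    have h2 : idem k l • x = 0 :=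
      idem_smul_of_ne (by rintro rfl; rw [Fin.le_def] at him; omega) hx
    rw [← h1, ← hv, standardDesc_apply, Finset.smul_sum]
    refine ⟨∑ c : Supp m, if c.1 = m then 0 else (show Supp m → k from v) c, ?_⟩
    rw [Finset.sum_smul]
    refine Finset.sum_congr rfl fun c _ => ?_
    rw [smul_comm (idem k l)]
    split_ifs
    · rw [h2, smul_zero, zero_smul]
    · rw [idem_smul_lower_smul hl]
  -- so `t` can be corrected by a multiple of `x` to a cycle of `M`
  refine hM i hi ⟨t - r • idem k i • x, ?_, ?_, fun s h => hs (P.mkQ s) ?_⟩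
  · rw [smul_sub, ht', smul_comm _ r, idem_smul_idem_smul, if_pos rfl]
  · rw [smul_sub, hr, smul_comm _ r, sub_self]
  · rw [← map_smul, h, map_sub, sub_eq_self, Submodule.mkQ_apply, Submodule.Quotient.mk_eq_zero]
    exact (P.restrictScalars k).smul_mem r (P.smul_mem _ hxP)

omit hm in
/-- The homomorphism `M → ∇(m)` given by a functional on `M_m` is surjective when the arrows `α`
are exact on `M`. -/
theorem costandardLift_surjective (hM : ∀ i : Fin n, 0 < (i : ℕ) → ¬ RaiseHomologyAt k M i)
    {φ : M →ₗ[k] k} (he : ∀ x, φ (idem k m • x) = φ x) (hd : ∀ x, φ (lower k n • x) = 0)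
    {x : M} (hx : idem k m • x = x) (hu : raise k n • x = 0) (hφ : φ x = 1) :
    Function.Surjective (costandardLift m φ he hd) := by
  intro w
  set w' : Supp m → k := w
  obtain ⟨y, hy⟩ : ∃ y : M, ∀ c : Supp m, c.1 ≠ m → φ y = 0 ∧ φ (raise k n • y) = w' c := by
    by_cases h0 : (m : ℕ) = 0
    · exact ⟨0, fun c hc => by have := c.2.resolve_left hc; omega⟩
    · obtain ⟨s, hs⟩ : ∃ s : M, raise k n • s = x := by
        by_contra! h
        exact hM m (Nat.pos_of_ne_zero h0) ⟨x, hx, hu, h⟩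
      obtain ⟨l, hl⟩ : ∃ l : Fin n, (l : ℕ) + 1 = m := ⟨⟨m - 1, by omega⟩, by simp; omega⟩
      refine ⟨w' ⟨l, Or.inr hl⟩ • idem k l • s, fun c hc => ⟨?_, ?_⟩⟩
      · have hlm : m ≠ l := by rintro rfl; omega
        rw [map_smul, ← he, idem_smul_idem_smul, if_neg hlm, map_zero, smul_zero]
      · obtain rfl : c = ⟨l, Or.inr hl⟩ :=
          Subtype.ext (Fin.ext (Nat.succ_injective ((c.2.resolve_left hc).trans hl.symm)))
        rw [smul_comm, map_smul, ← idem_smul_raise_smul hl, hs, hx, hφ, smul_eq_mul, mul_one]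
  refine ⟨y + (w' ⟨m, Or.inl rfl⟩ - φ y) • x, funext fun c => ?_⟩
  refine (costandardLift_apply he hd _ c).trans ?_
  split_ifs with hc
  · obtain rfl : c = ⟨m, Or.inl rfl⟩ := Subtype.ext hc
    simp [hφ, w']
  · rw [smul_add, smul_comm _ _ x, hu, smul_zero, add_zero, (hy c hc).2]

/-- Exactness of the arrows `α` passes to the kernel of `M → ∇(m)`. -/
theorem not_raiseHomologyAt_ker (hM : ∀ i : Fin n, 0 < (i : ℕ) → ¬ RaiseHomologyAt k M i)
    {φ : M →ₗ[k] k} (he : ∀ x, φ (idem k m • x) = φ x) (hd : ∀ x, φ (lower k n • x) = 0)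
    {i : Fin n} (hi : 0 < (i : ℕ)) :
    ¬ RaiseHomologyAt k (LinearMap.ker (costandardLift m φ he hd)) i := by
  rintro ⟨⟨t, htk⟩, ht, hu, hs⟩
  replace ht : idem k i • t = t := congrArg Subtype.val ht
  replace hu : raise k n • t = 0 := congrArg Subtype.val hu
  have him : i ≤ m := le_of_idem_smul_ne hm (t := t) fun h => hs 0 (Subtype.ext (by
    change raise k n • (0 : M) = t
    rw [← ht, h, smul_zero]))
  obtain ⟨s, rfl⟩ : ∃ s : M, raise k n • s = t := by
    by_contra! h
    exact hM i hi ⟨t, ht, hu, h⟩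
  obtain ⟨l, hl⟩ : ∃ l : Fin n, (l : ℕ) + 1 = i := ⟨⟨i - 1, by omega⟩, by simp; omega⟩
  rw [idem_smul_raise_smul hl] at ht
  refine hs ⟨idem k l • s, funext fun c => ?_⟩ (Subtype.ext ht)
  refine (costandardLift_apply he hd _ c).trans ?_
  have hlm : m ≠ l := by rintro rfl; rw [Fin.le_def] at him; omega
  split_ifs with hc
  · rw [← he, idem_smul_idem_smul, if_neg hlm, map_zero]; rfl
  · rw [ht]
    have := congrFun (htk : (_ : Supp m → k) = 0) ⟨m, Or.inl rfl⟩
    rw [costandardLift_apply, if_pos rfl] at this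
    exact this

end Exact

/-! ### Criteria for membership in `F(Δ)` and `F(∇)` -/

section Criterion

variable {k : Type u} [Field k] {n : ℕ}

/-- A finite-dimensional module on which the arrows `α'` are exact away from the first vertex has a
filtration by standard modules. -/
theorem hasFiltration_standard (M : Type u) [AddCommGroup M] [Module (Lam k n) M] [Module k M]
    [IsScalarTower k (Lam k n) M] [Module.Finite k M]
    (hM : ∀ i : Fin n, 0 < (i : ℕ) → ¬ LowerHomologyAt k M i) :
    HasFiltration (standard k (n := n)) (ModuleCat.of (Lam k n) M) := by
  induction hd : Module.finrank k M using Nat.strong_induction_on generalizing M with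
  | _ d ih =>
    subst hd
    rcases subsingleton_or_nontrivial M with _ | _
    · exact hasFiltration_of_subsingleton
    obtain ⟨m, x, hx0, hx, hm⟩ := exists_top_vertex (k := k) (n := n) (M := M)
    have hu := raise_smul_eq_zero_of_top hm hx
    let f := standardDesc m x hx hu
    refine HasFiltration.of_quotient (P := LinearMap.range f) m
      (LinearEquiv.ofInjective f (standardDesc_injective_of_top hm hM hx0 hx)).symm ?_
    refine ih _ ?_ (M ⧸ LinearMap.range f)
      (fun i hi => not_lowerHomologyAt_quotient hm hM hx hi) rfl
    have hxf : (⟨x, standardTop k m, standardDesc_standardTop hx hu⟩ :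
        (LinearMap.range f).restrictScalars k) ≠ 0 := fun h => hx0 (congrArg Subtype.val h)
    have : 0 < Module.finrank k ((LinearMap.range f).restrictScalars k) :=
      Module.finrank_pos_iff_exists_ne_zero.2 ⟨_, hxf⟩
    have h := Submodule.finrank_quotient_add_finrank ((LinearMap.range f).restrictScalars k)
    change Module.finrank k (M ⧸ LinearMap.range f) + _ = _ at h
    omega

/-- A finite-dimensional module on which the arrows `α` are exact away from the first vertex has a
filtration by costandard modules. -/
theorem hasFiltration_costandard (M : Type u) [AddCommGroup M] [Module (Lam k n) M] [Module k M]
    [IsScalarTower k (Lam k n) M] [Module.Finite k M]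
    (hM : ∀ i : Fin n, 0 < (i : ℕ) → ¬ RaiseHomologyAt k M i) :
    HasFiltration (costandard k (n := n)) (ModuleCat.of (Lam k n) M) := by
  induction hd : Module.finrank k M using Nat.strong_induction_on generalizing M with
  | _ d ih =>
    subst hd
    rcases subsingleton_or_nontrivial M with _ | _
    · exact hasFiltration_of_subsingleton
    obtain ⟨m, x, hx0, hx, hm⟩ := exists_top_vertex (k := k) (n := n) (M := M)
    obtain ⟨φ, hφ, he, hl⟩ := exists_functional hx fun s hs => hx0 (by
      rw [← hx, ← hs, idem_smul_lower_smul_of_top hm])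
    let g := costandardLift m φ he hl
    refine HasFiltration.of_ker (S := costandard k (n := n)) m g
      (costandardLift_surjective hM he hl hx (raise_smul_eq_zero_of_top hm hx) hφ) ?_
    have hlt : (LinearMap.ker g).restrictScalars k ≠ ⊤ := by
      intro h
      have hxg : x ∈ (LinearMap.ker g).restrictScalars k := h ▸ trivial
      have := congrFun (hxg : (_ : Supp m → k) = 0) ⟨m, Or.inl rfl⟩
      rw [costandardLift_apply, if_pos rfl, hφ] at this
      exact one_ne_zero this
    have : Module.Finite k (LinearMap.ker g) :=
      inferInstanceAs (Module.Finite k ((LinearMap.ker g).restrictScalars k))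
    exact ih _ (Submodule.finrank_lt hlt) (LinearMap.ker g)
      (fun i hi => not_raiseHomologyAt_ker hm hM he hl hi) rfl

open scoped ModuleCat

theorem exists_lowerHomologyAt {M : ModuleCat.{u} (Lam k n)} (hf : IsFinDim M)
    (h : ¬ InFDelta M) : ∃ i : Fin n, 0 < (i : ℕ) ∧ LowerHomologyAt k M i := by
  by_contra! hM
  have : Module.Finite k M := hf
  exact h ⟨hf, hasFiltration_standard M hM⟩

theorem exists_raiseHomologyAt {M : ModuleCat.{u} (Lam k n)} (hf : IsFinDim M)
    (h : ¬ InFNabla M) : ∃ i : Fin n, 0 < (i : ℕ) ∧ RaiseHomologyAt k M i := by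
  by_contra! hM
  have : Module.Finite k M := hf
  exact h ⟨hf, hasFiltration_costandard M hM⟩

/-- If `M` is not in `F(Δ)` and `N` is not in `F(∇)`, then some `Ext^m(M, N)` with `m > 0` is
nonzero. -/
theorem exists_nontrivial_ext {M N : ModuleCat.{u} (Lam k n)} (hM : IsFinDim M) (hN : IsFinDim N)
    (hM' : ¬ InFDelta M) (hN' : ¬ InFNabla N) :
    ∃ m : ℕ, 1 ≤ m ∧ Nontrivial (Abelian.Ext M N m) := by
  obtain ⟨j, hj, hMj⟩ := exists_lowerHomologyAt hM hM'
  obtain ⟨i, hi, hNi⟩ := exists_raiseHomologyAt hN hN'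
  exact ⟨i + j, by omega, nontrivial_ext_of_homology hi hj hMj hNi⟩

end Criterion

end DualExt

theorem mainTheorem6 (k : Type u) [Field k] [IsAlgClosed k] (n : ℕ) (hn : 1 < n) :
    (∀ M N : ModuleCat.{u} (DualExt.Lam k n),
      DualExt.InFNabla M → DualExt.InFDelta N →
      CategoryTheory.Indecomposable M → CategoryTheory.Indecomposable N →
      DualExt.IsSelfOrthogonal M → DualExt.IsSelfOrthogonal N →
      ¬ (DualExt.InFDelta M ∧ DualExt.InFNabla M) →
      ¬ (DualExt.InFDelta N ∧ DualExt.InFNabla N) →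
      ∃ m : ℕ, 1 ≤ m ∧ Nontrivial (CategoryTheory.Abelian.Ext M N m)) ∧
    (∀ T : ModuleCat.{u} (DualExt.Lam k n), DualExt.IsFinDim T →
      DualExt.IsGeneralizedTilting T → DualExt.InFDelta T ∨ DualExt.InFNabla T) := by
  refine ⟨fun M N hM hN _ _ _ _ hM' hN' => ?_, fun T hT h => ?_⟩
  · exact DualExt.exists_nontrivial_ext hM.1 hN.1 (fun h => hM' ⟨h, hM⟩) fun h => hN' ⟨hN, h⟩
  · by_contra! hn'
    obtain ⟨m, hm, hnt⟩ := DualExt.exists_nontrivial_ext hT hT hn'.1 hn'.2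
    have := h.selfOrthogonal m hm
    exact not_subsingleton _ this
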